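/- Let $k$ be an algebraically closed field of characteristic zero. For a $k$-algebra automorphism $\sigma$ of $k[h]$ and $a\in k[h]\setminus\{0\}$, the generalized Weyl algebra $k[h](\sigma,a)$ is the $k$-algebra generated over $k[h]$ by two elements $x,y$ subject to the relations $xh=\sigma(h)x$, $yh=\sigma^{-1}(h)y$, $xy=\sigma(a)$, $yx=a$. Let $\sigma_{cl}$ be the automorphism of $k[h]$ with $\sigma_{cl}(h)=h-1$. Let $a_1,a_2\in k[h]\setminus k$ be non-constant polynomials of degrees $n$ and $m$, and write $a_1=c_1\prod_{i=1}^n(h-\alpha_i)$ and $a_2=c_2\prod_{i=1}^m(h-\beta_i)$ with leading coefficients $c_1,c_2\in k^*$ and roots $\alpha_i,\beta_i\in k$ listed with multiplicity. Put $A=k[h](\sigma_{cl},a_1)$ and $B=k[h](\sigma_{cl},a_2)$. Then the following assertions are equivalent: 1. $A$ and $B$ are isomorphic as $k$-algebras; 2. $n=m$, and there exists a permutation $\tau\in\mathcal S_n$ such that $(\alpha_i-\alpha_j)^2=(\beta_{\tau(i)}-\beta_{\tau(j)})^2$ for all $1\le i,j\le n$; 3. $n=m$, and there exist a permutation $\tau\in\mathcal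 S_n$ and $\epsilon\in\{-1,1\}$ such that $\alpha_i-\alpha_1=\epsilon(\beta_{\tau(i)}-\beta_{\tau(1)})$ for all $1\le i\le n$. -/

import Mathlib

open Polynomial

/-- The three generators `h`, `x`, `y` of a generalized Weyl algebra over `k[h]`. -/
inductive GWAGen : Type
  | h
  | x
  | y

section GWADefs

variable {k : Type*} [Field k]

/-- The polynomial `p ∈ k[h]`, seen in the free algebra `k⟨h, x, y⟩` (evaluated at the
generator `h`). -/
noncomputable def GWAGen.poly (p : k[X]) : FreeAlgebra k GWAGen :=
  aeval (FreeAlgebra.ι k GWAGen.h) p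

/-- The defining relations of `k[h](σ, a)`:
`x h = σ(h) x`, `y h = σ⁻¹(h) y`, `x y = σ(a)`, `y x = a`. -/
inductive GWARel (σ : k[X] ≃ₐ[k] k[X]) (a : k[X]) :
    FreeAlgebra k GWAGen → FreeAlgebra k GWAGen → Prop
  | x_h : GWARel σ a (FreeAlgebra.ι k GWAGen.x * FreeAlgebra.ι k GWAGen.h)
      (GWAGen.poly (σ X) * FreeAlgebra.ι k GWAGen.x)
  | y_h : GWARel σ a (FreeAlgebra.ι k GWAGen.y * FreeAlgebra.ι k GWAGen.h)
      (GWAGen.poly (σ.symm X) * FreeAlgebra.ι k GWAGen.y)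
  | x_y : GWARel σ a (FreeAlgebra.ι k GWAGen.x * FreeAlgebra.ι k GWAGen.y)
      (GWAGen.poly (σ a))
  | y_x : GWARel σ a (FreeAlgebra.ι k GWAGen.y * FreeAlgebra.ι k GWAGen.x)
      (GWAGen.poly a)

/-- The generalized Weyl algebra `k[h](σ, a)` of degree one: the `k`-algebra generated over
`k[h]` by `x` and `y` subject to the relations `GWARel σ a`. -/
abbrev GWA (σ : k[X] ≃ₐ[k] k[X]) (a : k[X]) : Type _ :=
  RingQuot (GWARel σ a)

/-- The classical automorphism `σ_cl` of `k[h]`, determined by `σ_cl(h) = h - 1`. -/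
noncomputable def sigmaCl (k : Type*) [Field k] : k[X] ≃ₐ[k] k[X] :=
  algEquivOfCompEqX (X - 1) (X + 1) (by simp) (by simp)

theorem sigmaCl_X (k : Type*) [Field k] : sigmaCl k X = X - 1 := by
  simp [sigmaCl]

end GWADefs

/-! The implication 3 → 1 is explicit. Translating `h` and rescaling `y` replace `a` by a scalar
multiple of a translate, and `h ↦ 1 - h`, `x ↔ y` replaces `a(h)` by `a(-h)`. Conditions 2 and 3 are
equivalent by elementary algebra. The content is 1 → 3, which rests on a description of the locally
ad-nilpotent elements: up to triangular automorphisms and the swap, each is a polynomial in `x`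
(`exists_equiv_eq_aeval_genX`). This applies to the image of `x` under any isomorphism, because `x`
is locally ad-nilpotent.

For that description, an element is given a symbol in `k[h, x, x⁻¹]`, where `y` becomes `a(h) x⁻¹`.
For weights that are positive on `h`, the leading form of a commutator is the Poisson bracket with
`{h, x} = x`. Hence the leading form `f₀` of an ad-nilpotent element gives a derivation `{f₀, ·}`
nilpotent at `h`, `x` and `h ^ n x⁻¹`, with `n = deg a`. At the vertex of highest power `x ^ j` this
forces a constant coefficient (`coeff_top_eq_zero`). On the edge issuing from `x ^ j`, factorial
closedness of the kernel forces the shape `c x ^ j (h ^ p x ^ (-q) - r) ^ N`, and a count of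
nilpotency degrees gives `p = 1` (`edge_of_isNilAt`). The automorphism `h ↦ h + r x ^ q`, `x ↦ x`
then lowers the degree in `x`. The swap ensures that the positive side is the longer one, and
induction on the width finishes the reduction.

Suppose now that `x ↦ p(x)`. Centralizers force `p` to be linear. The relation `x h = (h - 1) x`
becomes a difference equation for the coefficients of the image of `h`; if the target polynomial has
degree at least two, that image is `h + c` plus positive powers of `x`. The degree-zero part of `y x
= a` then shows that `a₂(h)` or `a₂(-h)` divides `a₁(h + c)` (`exists_dvd_comp`). By symmetry the
degrees agree, so the roots correspond up to a sign and a translation. -/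

/-! ### Nilpotency degree of a derivation -/

section LocallyNilpotent

variable {k : Type*} [Field k] {A : Type*} [Ring A] [Algebra k A]

/-- `D` is nilpotent at `a`. -/
def IsNilAt (D : A →ₗ[k] A) (a : A) : Prop := ∃ N : ℕ, (D ^ N) a = 0

/-- `D ^ m` is the last power of `D` not killing `a`. -/
def HasNilDeg (D : A →ₗ[k] A) (a : A) (m : ℕ) : Prop := (D ^ m) a ≠ 0 ∧ (D ^ (m + 1)) a = 0

theorem pow_succ_apply_end (D : A →ₗ[k] A) (m : ℕ) (a : A) : (D ^ (m + 1)) a = (D ^ m) (D a) := by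
  rw [pow_succ, Module.End.mul_apply]

theorem pow_succ_apply_end' (D : A →ₗ[k] A) (m : ℕ) (a : A) : (D ^ (m + 1)) a = D ((D ^ m) a) := by
  rw [pow_succ', Module.End.mul_apply]

theorem pow_apply_eq_zero_of_le (D : A →ₗ[k] A) {m l : ℕ} (h : m ≤ l) {a : A}
    (ha : (D ^ m) a = 0) : (D ^ l) a = 0 := by
  obtain ⟨t, rfl⟩ := Nat.exists_eq_add_of_le' h
  rw [pow_add, Module.End.mul_apply, ha, map_zero]

/-- In the Leibniz expansion of `D ^ (m + l)` every term but one contains a power of `D` that kills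
its factor. -/
theorem pow_add_apply_mul {D : A →ₗ[k] A} (hD : ∀ a b, D (a * b) = D a * b + a * D b)
    (s : ℕ) : ∀ (m l : ℕ) (a b : A), m + l = s → (D ^ (m + 1)) a = 0 → (D ^ (l + 1)) b = 0 →
      (D ^ s) (a * b) = (s.choose m : A) * ((D ^ m) a * (D ^ l) b) := by
  induction s with
  | zero =>
    intro m l a b h _ _
    obtain ⟨rfl, rfl⟩ : m = 0 ∧ l = 0 := by omega
    simp
  | succ s ih =>
    intro m l a b h ha hb
    rw [pow_succ_apply_end, hD, map_add]
    rcases m with _ | m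
    · have h0 : D a = 0 := by simpa using ha
      obtain rfl : l = s + 1 := by omega
      rw [h0, zero_mul, map_zero, zero_add, ih 0 s a (D b) (by omega) ha
        (by rwa [← pow_succ_apply_end]), ← pow_succ_apply_end]
      simp
    · rcases l with _ | l
      · have h0 : D b = 0 := by simpa using hb
        obtain rfl : m = s := by omega
        rw [h0, mul_zero, map_zero, add_zero, ih m 0 (D a) b (by omega)
          (by rwa [← pow_succ_apply_end]) hb, ← pow_succ_apply_end]
        simp
      · rw [ih m (l + 1) (D a) b (by omega) (by rwa [← pow_succ_apply_end]) hb,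
          ih (m + 1) l a (D b) (by omega) ha (by rwa [← pow_succ_apply_end]),
          ← pow_succ_apply_end, ← pow_succ_apply_end, Nat.choose_succ_succ]
        push_cast
        rw [add_mul]

theorem IsNilAt.add {D : A →ₗ[k] A} {a b : A} (ha : IsNilAt D a) (hb : IsNilAt D b) :
    IsNilAt D (a + b) := by
  obtain ⟨m, hm⟩ := ha
  obtain ⟨l, hl⟩ := hb
  refine ⟨m + l, ?_⟩
  rw [map_add, pow_apply_eq_zero_of_le D (by omega) hm, pow_apply_eq_zero_of_le D (by omega) hl,
    add_zero]

theorem IsNilAt.mul {D : A →ₗ[k] A} (hD : ∀ a b, D (a * b) = D a * b + a * D b) {a b : A}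
    (ha : IsNilAt D a) (hb : IsNilAt D b) : IsNilAt D (a * b) := by
  obtain ⟨m, hm⟩ := ha
  obtain ⟨l, hl⟩ := hb
  refine ⟨m + l + 1, ?_⟩
  rw [pow_succ_apply_end', pow_add_apply_mul hD (m + l) m l a b rfl
    (pow_apply_eq_zero_of_le D (by omega) hm) (pow_apply_eq_zero_of_le D (by omega) hl), hm]
  simp

theorem map_one_eq_zero_of_leibniz {D : A →ₗ[k] A} (hD : ∀ a b, D (a * b) = D a * b + a * D b) :
    D 1 = 0 := by
  have := hD 1 1
  simpa using this

/-- The elements at which a derivation is nilpotent form a subalgebra. -/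
def nilSubalgebra (D : A →ₗ[k] A) (hD : ∀ a b, D (a * b) = D a * b + a * D b) :
    Subalgebra k A where
  carrier := {a | IsNilAt D a}
  mul_mem' := IsNilAt.mul hD
  add_mem' := IsNilAt.add
  algebraMap_mem' r := ⟨1, by
    rw [Algebra.algebraMap_eq_smul_one, map_smul, pow_one, map_one_eq_zero_of_leibniz hD,
      smul_zero]⟩

theorem mem_nilSubalgebra {D : A →ₗ[k] A} {hD : ∀ a b, D (a * b) = D a * b + a * D b} {a : A} :
    a ∈ nilSubalgebra D hD ↔ IsNilAt D a := Iff.rfl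

theorem isNilAt_of_apply {D : A →ₗ[k] A} {a : A} (h : IsNilAt D (D a)) : IsNilAt D a := by
  obtain ⟨m, hm⟩ := h
  exact ⟨m + 1, by rwa [pow_succ_apply_end]⟩

theorem HasNilDeg.unique {D : A →ₗ[k] A} {a : A} {m l : ℕ} (h : HasNilDeg D a m)
    (h' : HasNilDeg D a l) : m = l := by
  by_contra hne
  rcases Nat.lt_or_gt_of_ne hne with hlt | hlt
  · exact h'.1 (pow_apply_eq_zero_of_le D hlt h.2)
  · exact h.1 (pow_apply_eq_zero_of_le D hlt h'.2)

theorem IsNilAt.exists_hasNilDeg {D : A →ₗ[k] A} {a : A} (h : IsNilAt D a) (ha : a ≠ 0) :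
    ∃ m, HasNilDeg D a m := by
  classical
  obtain ⟨m, hm⟩ : ∃ m, Nat.find h = m + 1 := by
    refine Nat.exists_eq_succ_of_ne_zero fun h0 => ha ?_
    simpa [h0] using Nat.find_spec h
  refine ⟨m, Nat.find_min h (by omega), ?_⟩
  rw [← hm]
  exact Nat.find_spec h

theorem hasNilDeg_zero_iff {D : A →ₗ[k] A} {a : A} : HasNilDeg D a 0 ↔ a ≠ 0 ∧ D a = 0 := by
  simp [HasNilDeg]

theorem HasNilDeg.apply {D : A →ₗ[k] A} {a : A} {m : ℕ} (h : HasNilDeg D a (m + 1)) :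
    HasNilDeg D (D a) m :=
  ⟨by rw [← pow_succ_apply_end]; exact h.1, by rw [← pow_succ_apply_end]; exact h.2⟩

theorem HasNilDeg.smul {D : A →ₗ[k] A} {a : A} {m : ℕ} (ha : HasNilDeg D a m) {c : k}
    (hc : c ≠ 0) : HasNilDeg D (c • a) m := by
  refine ⟨?_, ?_⟩
  · rw [map_smul]; exact smul_ne_zero hc ha.1
  · rw [map_smul, ha.2, smul_zero]

variable [CharZero k] [IsDomain A]

/-- The surviving binomial coefficient is nonzero in characteristic zero, so in a domain nilpotency
degrees add, as degrees of polynomials do. -/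
theorem HasNilDeg.mul {D : A →ₗ[k] A} (hD : ∀ a b, D (a * b) = D a * b + a * D b) {a b : A}
    {m l : ℕ} (ha : HasNilDeg D a m) (hb : HasNilDeg D b l) : HasNilDeg D (a * b) (m + l) := by
  have : CharZero A := charZero_of_injective_algebraMap (FaithfulSMul.algebraMap_injective k A)
  have key := pow_add_apply_mul hD (m + l) m l a b rfl ha.2 hb.2
  refine ⟨?_, ?_⟩
  · rw [key]
    refine mul_ne_zero ?_ (mul_ne_zero ha.1 hb.1)
    exact_mod_cast (Nat.choose_pos (by omega)).ne'
  · rw [pow_succ_apply_end', key, Nat.cast_comm, ← nsmul_eq_mul', map_nsmul, hD,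
      ← pow_succ_apply_end', ← pow_succ_apply_end', ha.2, hb.2]
    simp

theorem HasNilDeg.pow {D : A →ₗ[k] A} (hD : ∀ a b, D (a * b) = D a * b + a * D b) {a : A}
    {m : ℕ} (ha : HasNilDeg D a m) (s : ℕ) : HasNilDeg D (a ^ s) (s * m) := by
  induction s with
  | zero =>
    rw [pow_zero, zero_mul]
    exact hasNilDeg_zero_iff.2 ⟨one_ne_zero, map_one_eq_zero_of_leibniz hD⟩
  | succ s ih =>
    rw [pow_succ, Nat.succ_mul]
    exact ih.mul hD ha

/-- The kernel of a derivation is factorially closed in the subalgebra of nilpotency. -/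
theorem apply_eq_zero_of_apply_mul_eq_zero {D : A →ₗ[k] A}
    (hD : ∀ a b, D (a * b) = D a * b + a * D b) {a b : A} (ha : IsNilAt D a) (hb : IsNilAt D b)
    (hab : a * b ≠ 0) (h : D (a * b) = 0) : D a = 0 ∧ D b = 0 := by
  obtain ⟨m, hm⟩ := ha.exists_hasNilDeg (left_ne_zero_of_mul hab)
  obtain ⟨l, hl⟩ := hb.exists_hasNilDeg (right_ne_zero_of_mul hab)
  -- Degrees add, and a nonzero element of the kernel has degree zero.
  have := (hm.mul hD hl).unique (hasNilDeg_zero_iff.2 ⟨hab, h⟩)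
  obtain ⟨rfl, rfl⟩ : m = 0 ∧ l = 0 := by omega
  exact ⟨(hasNilDeg_zero_iff.1 hm).2, (hasNilDeg_zero_iff.1 hl).2⟩

end LocallyNilpotent

/-! ### The symbol ring and its Poisson bracket -/

/-- The commutative ring `k[h, x, x⁻¹]` in which the symbols of elements of a generalized Weyl
algebra live; the pair `(i, l)` stands for the monomial `h ^ i * x ^ l`. -/
abbrev SymbolRing (k : Type*) [Field k] := AddMonoidAlgebra k (ℕ × ℤ)

namespace SymbolRing

section Basic

variable {k : Type*} [Field k]

/-- The monomial `h ^ i * x ^ l`. -/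
noncomputable def mon (i : ℕ) (l : ℤ) : SymbolRing k := AddMonoidAlgebra.single (i, l) 1

theorem mon_mul (i i' : ℕ) (l l' : ℤ) :
    (mon i l * mon i' l' : SymbolRing k) = mon (i + i') (l + l') := by
  simp [mon, AddMonoidAlgebra.single_mul_single]

theorem mon_zero : (mon 0 0 : SymbolRing k) = 1 := rfl

theorem mon_pow (i : ℕ) (l : ℤ) (s : ℕ) : (mon i l : SymbolRing k) ^ s = mon (s * i) (s * l) := by
  simp [mon, AddMonoidAlgebra.single_pow]

theorem mon_ne_zero (i : ℕ) (l : ℤ) : (mon i l : SymbolRing k) ≠ 0 := by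
  simp [mon]

theorem coeff_mon (i i' : ℕ) (l l' : ℤ) :
    (mon i l : SymbolRing k).coeff (i', l') = if i = i' ∧ l = l' then 1 else 0 := by
  classical
  simp only [mon, AddMonoidAlgebra.coeff_single, Finsupp.single_apply, Prod.mk.injEq]

theorem coeff_mon_mul (i i' : ℕ) (l l' : ℤ) (f : SymbolRing k) :
    (mon i l * f).coeff (i + i', l + l') = f.coeff (i', l') := by
  rw [mon, show ((i + i', l + l') : ℕ × ℤ) = (i, l) + (i', l') from rfl,
    AddMonoidAlgebra.coeff_single_mul_eq_mul_coeff (i', l')]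
  · simp
  · intro m _
    simp [Prod.ext_iff]

/-- The linear map with prescribed values on monomials. -/
noncomputable def linOfMon {N : Type*} [AddCommGroup N] [Module k N] (φ : ℕ → ℤ → N) :
    SymbolRing k →ₗ[k] N :=
  (AddMonoidAlgebra.basis (ℕ × ℤ) k).constr k fun m => φ m.1 m.2

theorem linOfMon_mon {N : Type*} [AddCommGroup N] [Module k N] (φ : ℕ → ℤ → N) (i : ℕ) (l : ℤ) :
    linOfMon (k := k) φ (mon i l) = φ i l := by
  have := (AddMonoidAlgebra.basis (ℕ × ℤ) k).constr_basis k (fun m => φ m.1 m.2) (i, l)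
  simpa [linOfMon, mon] using this

theorem lin_ext {N : Type*} [AddCommGroup N] [Module k N] {S T : SymbolRing k →ₗ[k] N}
    (h : ∀ i l, S (mon i l) = T (mon i l)) : S = T :=
  (AddMonoidAlgebra.basis (ℕ × ℤ) k).ext fun m => by simpa [mon] using h m.1 m.2

/-- Elements all of whose monomials `h ^ i * x ^ l` satisfy `P i l`. -/
noncomputable def supp (P : ℕ → ℤ → Prop) : Submodule k (SymbolRing k) :=
  AddMonoidAlgebra.supported k k {m | P m.1 m.2}

theorem mem_supp {P : ℕ → ℤ → Prop} {f : SymbolRing k} :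
    f ∈ supp P ↔ ∀ i l, f.coeff (i, l) ≠ 0 → P i l := by
  rw [supp, AddMonoidAlgebra.mem_supported']
  simp [not_imp_comm]

theorem mon_mem_supp {P : ℕ → ℤ → Prop} {i : ℕ} {l : ℤ} (h : P i l) :
    (mon i l : SymbolRing k) ∈ supp P := by
  rw [mem_supp]
  intro i' l' h'
  rw [coeff_mon] at h'
  obtain ⟨rfl, rfl⟩ : i = i' ∧ l = l' := by
    by_contra hc
    exact h' (if_neg hc)
  exact h

theorem supp_mono {P Q : ℕ → ℤ → Prop} (h : ∀ i l, P i l → Q i l) :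
    (supp P : Submodule k (SymbolRing k)) ≤ supp Q := fun f hf => by
  rw [mem_supp] at hf ⊢
  exact fun i l hil => h i l (hf i l hil)

theorem map_mem_of_supp {N : Type*} [AddCommGroup N] [Module k N] (T : SymbolRing k →ₗ[k] N)
    {P : ℕ → ℤ → Prop} (M : Submodule k N) (h : ∀ i l, P i l → T (mon i l) ∈ M)
    {f : SymbolRing k} (hf : f ∈ supp P) : T f ∈ M := by
  have : supp P ≤ M.comap T := by
    rw [supp, AddMonoidAlgebra.supported_eq_span_single, Submodule.span_le]
    rintro _ ⟨m, hm, rfl⟩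
    exact h m.1 m.2 hm
  exact this hf

theorem map₂_mem_of_supp {N : Type*} [AddCommGroup N] [Module k N]
    (T : SymbolRing k →ₗ[k] SymbolRing k →ₗ[k] N) {P Q : ℕ → ℤ → Prop} (M : Submodule k N)
    (h : ∀ i l i' l', P i l → Q i' l' → T (mon i l) (mon i' l') ∈ M)
    {f g : SymbolRing k} (hf : f ∈ supp P) (hg : g ∈ supp Q) : T f g ∈ M := by
  refine map_mem_of_supp (T.flip g) M (fun i l hil => ?_) hf
  exact map_mem_of_supp (T (mon i l)) M (fun i' l' hil' => h i l i' l' hil hil') hg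

theorem leibniz_of_mon (T : SymbolRing k →ₗ[k] SymbolRing k)
    (h : ∀ i l i' l', T (mon i l * mon i' l') = mon i l * T (mon i' l') + mon i' l' * T (mon i l))
    (a b : SymbolRing k) : T (a * b) = a • T b + b • T a := by
  simp only [smul_eq_mul]
  induction a using AddMonoidAlgebra.induction_linear with
  | zero => simp
  | add f g hf hg => rw [add_mul, map_add, hf, hg, map_add]; ring
  | single m r =>
    induction b using AddMonoidAlgebra.induction_linear with
    | zero => simp
    | add f g hf hg => rw [mul_add, map_add, hf, hg, map_add]; ring
    | single m' r' =>
      have e : ∀ (m : ℕ × ℤ) (r : k), (AddMonoidAlgebra.single m r : SymbolRing k) =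
          r • mon m.1 m.2 := fun m r => by simp [mon]
      simp only [e, smul_mul_smul_comm, map_smul, h, smul_add]
      rw [mul_comm r r']

/-- The linear map underlying `∂/∂h`. -/
noncomputable def dhLin : SymbolRing k →ₗ[k] SymbolRing k :=
  linOfMon fun i l => (i : k) • mon (i - 1) l

/-- The linear map underlying `x ∂/∂x`. -/
noncomputable def exLin : SymbolRing k →ₗ[k] SymbolRing k :=
  linOfMon fun i l => (l : k) • mon i l

/-- The derivation `∂/∂h`. -/
noncomputable def dh : Derivation k (SymbolRing k) (SymbolRing k) :=
  Derivation.mk' dhLin <| leibniz_of_mon _ fun i l i' l' => by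
    simp only [dhLin, mon_mul, linOfMon_mon, mul_smul_comm]
    rcases i with _ | i <;> rcases i' with _ | i'
    · simp
    · simp
    · simp [add_comm]
    · have e1 : i + 1 + (i' + 1) - 1 = i + i' + 1 := by omega
      have e2 : i + 1 + (i' + 1 - 1) = i + i' + 1 := by omega
      have e3 : i' + 1 + (i + 1 - 1) = i + i' + 1 := by omega
      simp only [e1, e2, e3, ← add_smul, add_comm l' l]
      congr 1
      push_cast
      ring

/-- The Euler derivation `x ∂/∂x`. -/
noncomputable def ex : Derivation k (SymbolRing k) (SymbolRing k) :=
  Derivation.mk' exLin <| leibniz_of_mon _ fun i l i' l' => by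
    simp only [exLin, mon_mul, linOfMon_mon, mul_smul_comm, add_comm l' l, add_comm i' i,
      ← add_smul]
    congr 1
    push_cast
    ring

theorem dh_mon (i : ℕ) (l : ℤ) : dh (mon i l : SymbolRing k) = (i : k) • mon (i - 1) l := by
  rw [dh, Derivation.coe_mk', dhLin, linOfMon_mon]

theorem ex_mon (i : ℕ) (l : ℤ) : ex (mon i l : SymbolRing k) = (l : k) • mon i l := by
  rw [ex, Derivation.coe_mk', exLin, linOfMon_mon]

/-- The Poisson bracket `{f, ·}` with `{h, x} = x`. -/
noncomputable def bracket (f : SymbolRing k) : Derivation k (SymbolRing k) (SymbolRing k) :=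
  dh f • ex - ex f • dh

theorem bracket_apply (f g : SymbolRing k) : bracket f g = dh f * ex g - ex f * dh g := rfl

theorem bracket_self (f : SymbolRing k) : bracket f f = 0 := by
  rw [bracket_apply]; ring

theorem bracket_leibniz (f a b : SymbolRing k) :
    (bracket f : SymbolRing k →ₗ[k] SymbolRing k) (a * b) =
      (bracket f : SymbolRing k →ₗ[k] SymbolRing k) a * b +
        a * (bracket f : SymbolRing k →ₗ[k] SymbolRing k) b := by
  simp only [Derivation.coeFn_coe, Derivation.leibniz, smul_eq_mul]
  ring

theorem coeff_aeval_mon {p : ℕ} (hp : p ≠ 0) (l : ℤ) (P : k[X]) (t : ℕ) :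
    (aeval (mon p l : SymbolRing k) P).coeff (t * p, t * l) = P.coeff t := by
  induction P using Polynomial.induction_on' with
  | add P Q hP hQ => simp [hP, hQ]
  | monomial s r =>
    rw [aeval_monomial, mon_pow, ← Algebra.smul_def, AddMonoidAlgebra.coeff_smul_apply, coeff_mon,
      coeff_monomial]
    by_cases h : s = t
    · simp [h]
    · have : ¬ (s * p = t * p ∧ (s : ℤ) * l = t * l) := fun h' =>
        h (Nat.eq_of_mul_eq_mul_right (Nat.pos_of_ne_zero hp) h'.1)
      rw [if_neg this, if_neg h, smul_zero]

theorem aeval_mon_injective {p : ℕ} (hp : p ≠ 0) (l : ℤ) :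
    Function.Injective (aeval (mon p l : SymbolRing k) : k[X] →ₐ[k] SymbolRing k) := by
  intro P Q h
  ext t
  rw [← coeff_aeval_mon hp l, h, coeff_aeval_mon hp l]

end Basic

end SymbolRing

/-! ### Locally nilpotent Hamiltonians supported on one edge -/

namespace SymbolRing

section Edge

variable {k : Type*} [Field k]

/-- The exponents with `0 ≤ i + n l` form a semigroup generated by those of `h`, `x` and `h ^ n
x⁻¹`; the last is the leading monomial of `y`. -/
theorem isNilAt_mon {D : SymbolRing k →ₗ[k] SymbolRing k}
    (hD : ∀ a b, D (a * b) = D a * b + a * D b) {n : ℕ} (hh : IsNilAt D (mon 1 0))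
    (hx : IsNilAt D (mon 0 1)) (hy : IsNilAt D (mon n (-1))) {i : ℕ} {l : ℤ}
    (hil : 0 ≤ i + n * l) : IsNilAt D (mon i l) := by
  rw [← mem_nilSubalgebra (hD := hD)] at *
  rcases le_or_gt 0 l with hl | hl
  · lift l to ℕ using hl
    have : (mon i l : SymbolRing k) = mon 1 0 ^ i * mon 0 1 ^ l := by
      simp [mon_pow, mon_mul]
    rw [this]
    exact mul_mem (pow_mem hh _) (pow_mem hx _)
  · obtain ⟨m, hm⟩ : ∃ m : ℕ, l = -m := ⟨l.natAbs, by omega⟩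
    subst hm
    obtain ⟨t, rfl⟩ : ∃ t, i = t + m * n := by
      refine Nat.exists_eq_add_of_le' ?_
      have : ((m * n : ℕ) : ℤ) ≤ i := by push_cast; linarith
      exact_mod_cast this
    have : (mon (t + m * n) (-m) : SymbolRing k) = mon 1 0 ^ t * mon n (-1) ^ m := by
      simp [mon_pow, mon_mul]
    rw [this]
    exact mul_mem (pow_mem hh _) (pow_mem hy _)

/-- The hypothesis `h` says that every monomial `x ^ c (h ^ p x ^ (-q)) ^ t` lies in the cone of
`isNilAt_mon`. -/
theorem isNilAt_mon_mul_aeval {D : SymbolRing k →ₗ[k] SymbolRing k}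
    (hD : ∀ a b, D (a * b) = D a * b + a * D b) {n : ℕ} (hh : IsNilAt D (mon 1 0))
    (hx : IsNilAt D (mon 0 1)) (hy : IsNilAt D (mon n (-1))) {c p q : ℕ} (Q : k[X])
    (h : ∀ t ≤ Q.natDegree, n * q * t ≤ n * c + p * t) :
    IsNilAt D (mon 0 c * aeval (mon p (-q)) Q) := by
  rw [← mem_nilSubalgebra (hD := hD), aeval_eq_sum_range, Finset.mul_sum]
  refine sum_mem fun t ht => ?_
  rw [mul_smul_comm, mon_pow, mon_mul]
  refine Subalgebra.smul_mem _ (mem_nilSubalgebra.2 (isNilAt_mon hD hh hx hy ?_)) _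
  have := h t (by simpa [Nat.lt_succ_iff] using ht)
  zify at this
  push_cast
  nlinarith

theorem bracket_x (f : SymbolRing k) : bracket f (mon 0 1) = dh f * mon 0 1 := by
  simp [bracket_apply, ex_mon, dh_mon]

theorem dh_edge (j p q : ℕ) (P : k[X]) :
    dh (mon 0 j * aeval (mon p (-q)) P : SymbolRing k) =
      mon 0 j * (aeval (mon p (-q)) (derivative P) * dh (mon p (-q))) := by
  simp [Derivation.map_aeval, dh_mon]

theorem dh_edge_ne_zero [CharZero k] (j q : ℕ) {p : ℕ} (hp : p ≠ 0) {P : k[X]}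
    (hP : P.natDegree ≠ 0) : dh (mon 0 j * aeval (mon p (-q)) P : SymbolRing k) ≠ 0 := by
  rw [dh_edge]
  refine mul_ne_zero (mon_ne_zero _ _) (mul_ne_zero ?_ ?_)
  · rw [Ne, map_eq_zero_iff _ (aeval_mon_injective hp _)]
    exact fun h => hP (derivative_eq_zero.1 h)
  · rw [dh_mon]
    exact smul_ne_zero (by exact_mod_cast hp) (mon_ne_zero _ _)

theorem h_mul_dh_mon (i : ℕ) (l : ℤ) :
    mon 1 0 * dh (mon i l : SymbolRing k) = (i : k) • mon i l := by
  rcases i with _ | i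
  · simp [dh_mon]
  · rw [dh_mon, mul_smul_comm, mon_mul]
    congr 2 <;> simp [add_comm]

/-- With `w = h ^ p x ^ l` and `D` the bracket, both equations read `P(w) D(x ^ s) + x ^ s P'(w)
D(w) = 0`. Eliminating `D(x ^ s)` leaves the Wronskian times the nonzero factor `x ^ s D(w)`. -/
theorem wronskian_of_bracket_eq_zero (f : SymbolRing k) {s p : ℕ} (hp : p ≠ 0) {l : ℤ}
    {P Q : k[X]} (hw : bracket f (mon p l) ≠ 0)
    (hP : bracket f (mon 0 s * aeval (mon p l) P) = 0)
    (hQ : bracket f (mon 0 s * aeval (mon p l) Q) = 0) :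
    derivative P * Q = P * derivative Q := by
  rw [Derivation.leibniz, Derivation.map_aeval] at hP hQ
  simp only [smul_eq_mul] at hP hQ
  apply aeval_mon_injective hp l
  have hne : (mon 0 s * bracket f (mon p l) : SymbolRing k) ≠ 0 :=
    mul_ne_zero (mon_ne_zero _ _) hw
  apply mul_left_cancel₀ hne
  simp only [map_mul]
  linear_combination aeval (mon p l) Q * hP - aeval (mon p l) P * hQ

/-- Write `Q = (X - r) ^ e Q₂` with `Q₂(r) ≠ 0`. The equation becomes `e Q₂ + (X - r) Q₂' = M Q₂`;
at `r` it gives `e = M`, and then `Q₂' = 0`. -/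
theorem eq_C_mul_pow_of_wronskian [CharZero k] {Q : k[X]} {r : k} {M : ℕ} (hQ : Q ≠ 0)
    (h : derivative Q * (X - C r) ^ M = Q * derivative ((X - C r) ^ M)) :
    ∃ c, c ≠ 0 ∧ Q = C c * (X - C r) ^ M := by
  obtain ⟨Q₂, hQ₂, hndvd⟩ := exists_eq_pow_rootMultiplicity_mul_and_not_dvd Q hQ r
  set e := Q.rootMultiplicity r
  have hL : (X - C r : k[X]) ≠ 0 := X_sub_C_ne_zero r
  have key : ∀ s : ℕ, (X - C r) * derivative ((X - C r) ^ s) = C (s : k) * (X - C r) ^ s := by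
    intro s
    rcases s with _ | s
    · simp
    · rw [derivative_X_sub_C_pow]
      push_cast
      simp
      ring
  have h2 : C (e : k) * Q₂ + (X - C r) * derivative Q₂ = C (M : k) * Q₂ := by
    have h3 := congrArg (fun t => (X - C r) * t) h
    rw [hQ₂, derivative_mul] at h3
    have hpow : ((X - C r) ^ e * (X - C r) ^ M : k[X]) ≠ 0 :=
      mul_ne_zero (pow_ne_zero _ hL) (pow_ne_zero _ hL)
    apply mul_left_cancel₀ hpow
    linear_combination h3 - (Q₂ * (X - C r) ^ M) * key e + ((X - C r) ^ e * Q₂) * key M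
  have hr : Q₂.eval r ≠ 0 := fun h0 => hndvd (dvd_iff_isRoot.2 h0)
  have heM : (e : k) = M := by
    have := congrArg (eval r) h2
    simp only [eval_add, eval_mul, eval_C, eval_sub, eval_X, sub_self, zero_mul, add_zero] at this
    exact mul_right_cancel₀ hr this
  have hd : derivative Q₂ = 0 := by
    rw [heM, add_eq_left] at h2
    exact (mul_eq_zero.1 h2).resolve_left hL
  have hc := eq_C_of_natDegree_eq_zero (derivative_eq_zero.1 hd)
  have heM' : e = M := by exact_mod_cast heM
  refine ⟨Q₂.coeff 0, fun h0 => hr (by rw [hc, h0]; simp), ?_⟩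
  rw [← hc, mul_comm, ← heM', ← hQ₂]

/-- The edge polynomial of a locally nilpotent Hamiltonian is a power of a linear polynomial, and
its slope is constrained. -/
theorem edge_of_isNilAt [CharZero k] [IsAlgClosed k] {n j p q : ℕ} (hn : 0 < n) (hj : 0 < j)
    (hp : 0 < p) {P : k[X]} (hP0 : P.coeff 0 ≠ 0) (hP : P.natDegree ≠ 0) {f : SymbolRing k}
    (hf : f = mon 0 j * aeval (mon p (-q)) P)
    (hh : IsNilAt (bracket f : SymbolRing k →ₗ[k] SymbolRing k) (mon 1 0))
    (hx : IsNilAt (bracket f : SymbolRing k →ₗ[k] SymbolRing k) (mon 0 1))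
    (hy : IsNilAt (bracket f : SymbolRing k →ₗ[k] SymbolRing k) (mon n (-1)))
    (hcone : n * q * P.natDegree ≤ n * j + p * P.natDegree) (hj2 : q * P.natDegree ≤ 2 * j) :
    p = 1 ∧ n * q * P.natDegree = n * j + P.natDegree ∧
      ∃ c r, c ≠ 0 ∧ r ≠ 0 ∧ P = C c * (X - C r) ^ P.natDegree := by
  set D : SymbolRing k →ₗ[k] SymbolRing k := (bracket f : SymbolRing k →ₗ[k] SymbolRing k) with hDdef
  have hD : ∀ a b, D (a * b) = D a * b + a * D b := bracket_leibniz f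
  have hDb : ∀ a, D a = bracket f a := fun a => rfl
  have hPne : P ≠ 0 := fun h => hP (by simp [h])
  have hinj := aeval_mon_injective (k := k) hp.ne' (-q)
  have hDx : D (mon 0 1) ≠ 0 := by
    rw [hDb, bracket_x, hf]
    exact mul_ne_zero (dh_edge_ne_zero j q hp.ne' hP) (mon_ne_zero _ _)
  have hDxj : ∀ s : ℕ, 0 < s → D (mon 0 s) ≠ 0 := by
    intro s hs
    have : (mon 0 s : SymbolRing k) = mon 0 1 ^ s := by simp [mon_pow]
    rw [this, hDb, Derivation.leibniz_pow, ← Nat.cast_smul_eq_nsmul k]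
    exact smul_ne_zero (by exact_mod_cast hs.ne')
      (smul_ne_zero (pow_ne_zero _ (mon_ne_zero _ _)) hDx)
  have hfne : f ≠ 0 := by
    rw [hf]
    refine mul_ne_zero (mon_ne_zero _ _) ?_
    rwa [Ne, map_eq_zero_iff _ hinj]
  have hDf : D f = 0 := bracket_self f
  -- Otherwise all powers of `h ^ p x ^ (-q)` lie in the cone, and the factorization `f = x ^ j · P`
  -- would put `x ^ j` in the kernel.
  have hA : p < n * q := by
    by_contra hle
    push Not at hle
    have h1 : IsNilAt D (mon 0 (0 : ℕ) * aeval (mon p (-q)) P) :=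
      isNilAt_mon_mul_aeval hD hh hx hy P fun t _ => by
        have := Nat.mul_le_mul_right t hle
        omega
    rw [Nat.cast_zero, mon_zero, one_mul] at h1
    have h2 : IsNilAt D (mon 0 j) := isNilAt_mon hD hh hx hy (by positivity)
    rw [hf] at hfne
    have h3 : D (mon 0 j * aeval (mon p (-q)) P) = 0 := by rw [← hf]; exact hDf
    exact hDxj j hj (apply_eq_zero_of_apply_mul_eq_zero hD h2 h1 hfne h3).1
  -- With `w = h ^ p x ^ (-q)` and `y = h ^ n x⁻¹`, this `A` is the exponent for which `x ^ A w ^ n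
  -- = y ^ p`.
  obtain ⟨A, hAeq⟩ : ∃ A, n * q = p + A := Nat.exists_eq_add_of_le hA.le
  have hApos : 0 < A := by omega
  have hAN : A * P.natDegree ≤ n * j := by
    rw [hAeq] at hcone
    nlinarith
  obtain ⟨r, hr⟩ := IsAlgClosed.exists_root P fun h => hP (natDegree_eq_of_degree_eq_some h)
  obtain ⟨P₂, hP₂⟩ := dvd_iff_isRoot.2 hr
  have hr0 : r ≠ 0 := by
    rintro rfl
    exact hP0 (by rw [coeff_zero_eq_eval_zero]; exact hr)
  have hP₂ne : P₂ ≠ 0 := fun h => hPne (by rw [hP₂, h, mul_zero])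
  have hL : (X - C r : k[X]) ≠ 0 := X_sub_C_ne_zero r
  have hdeg : P.natDegree = P₂.natDegree + 1 := by
    rw [hP₂, natDegree_mul hL hP₂ne, natDegree_X_sub_C, add_comm]
  set w : SymbolRing k := mon p (-q) with hw
  -- The monomial `x ^ A w ^ t` has cone value `A (n - t)`, so `g` lies in the cone. It divides `f ^
  -- n` with cofactor in the cone, hence lies in the kernel.
  set g : SymbolRing k := mon 0 A * aeval w ((X - C r) ^ n) with hg
  have hgne : g ≠ 0 := by
    refine mul_ne_zero (mon_ne_zero _ _) ?_
    rw [Ne, map_eq_zero_iff _ hinj]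
    exact pow_ne_zero _ hL
  have hAnj : A ≤ n * j := by
    refine le_trans ?_ hAN
    exact Nat.le_mul_of_pos_right _ (Nat.pos_of_ne_zero hP)
  have hDg : D g = 0 := by
    have h1 : IsNilAt D g := isNilAt_mon_mul_aeval hD hh hx hy _ fun t ht => by
      rw [natDegree_pow, natDegree_X_sub_C, mul_one] at ht
      rw [hAeq]
      nlinarith
    have h2 : IsNilAt D (mon 0 (n * j - A : ℕ) * aeval w (P₂ ^ n)) :=
      isNilAt_mon_mul_aeval hD hh hx hy _ fun t ht => by
        rw [natDegree_pow] at ht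
        rw [hAeq]
        rw [hdeg] at hAN
        obtain ⟨u, hu⟩ := Nat.exists_eq_add_of_le hAN
        have : n * j - A = A * P₂.natDegree + u := by rw [hu]; rw [mul_add]; omega
        rw [this]
        nlinarith [Nat.mul_le_mul_left A ht, Nat.zero_le (n * u)]
    have h3 : g * (mon 0 (n * j - A : ℕ) * aeval w (P₂ ^ n)) = f ^ n := by
      rw [hf, hg, mul_pow, mon_pow, ← map_pow, hP₂, mul_pow, map_mul]
      have : (mon 0 A * mon 0 (n * j - A : ℕ) : SymbolRing k) = mon (n * 0) (n * j) := by
        rw [mon_mul]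
        congr 1
        push_cast [Nat.cast_sub hAnj]
        ring
      rw [← this]
      ring
    refine (apply_eq_zero_of_apply_mul_eq_zero hD h1 h2 ?_ ?_).1
    · rw [h3]; exact pow_ne_zero _ hfne
    · rw [h3, hDb, Derivation.leibniz_pow, ← hDb, hDf]; simp
  have hDw : bracket f w ≠ 0 := by
    intro h0
    have h1 := hDf
    rw [hDb] at h1
    nth_rewrite 2 [hf] at h1
    rw [Derivation.leibniz, Derivation.map_aeval, h0, smul_zero, smul_zero, zero_add,
      smul_eq_mul, mul_eq_zero] at h1
    rcases h1 with h1 | h1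
    · exact hPne ((map_eq_zero_iff _ hinj).1 h1)
    · exact hDxj j hj h1
  -- The kernel elements `f ^ A` and `g ^ j` carry the same power `x ^ (A j)`, so the Wronskian of
  -- `P ^ A` and `(X - r) ^ (n j)` vanishes. This gives the shape of `P`, and comparing degrees
  -- gives `A deg P = n j`.
  obtain ⟨hANeq, c, hc, hPc⟩ : A * P.natDegree = n * j ∧
      ∃ c, c ≠ 0 ∧ P = C c * (X - C r) ^ P.natDegree := by
    have h1 : bracket f (mon 0 (A * j : ℕ) * aeval w (P ^ A)) = 0 := by
      have : (mon 0 (A * j : ℕ) * aeval w (P ^ A) : SymbolRing k) = f ^ A := by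
        rw [hf, mul_pow, mon_pow, map_pow]
        simp
      rw [this, Derivation.leibniz_pow, ← hDb, hDf]; simp
    have h2 : bracket f (mon 0 (A * j : ℕ) * aeval w ((X - C r) ^ (n * j))) = 0 := by
      have : (mon 0 (A * j : ℕ) * aeval w ((X - C r) ^ (n * j)) : SymbolRing k) = g ^ j := by
        rw [hg, mul_pow, mon_pow, ← map_pow, ← pow_mul]
        congr 2
        push_cast; ring
      rw [this, Derivation.leibniz_pow, ← hDb, hDg]; simp
    have h3 := wronskian_of_bracket_eq_zero f hp.ne' hDw h1 h2
    obtain ⟨c', hc', h4⟩ := eq_C_mul_pow_of_wronskian (pow_ne_zero A hPne) h3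
    have h5 : P ∣ (X - C r) ^ (n * j) := by
      refine (dvd_pow_self P hApos.ne').trans ?_
      rw [h4]
      refine ⟨C c'⁻¹, ?_⟩
      rw [mul_right_comm, ← C_mul, mul_inv_cancel₀ hc', C_1, one_mul]
    obtain ⟨i, -, u, hu⟩ := (dvd_prime_pow (prime_X_sub_C r) _).1 h5
    obtain ⟨c, hc, hcu⟩ := Polynomial.isUnit_iff.1 (u⁻¹).isUnit
    have h6 : P = C c * (X - C r) ^ i := by
      rw [← hu, hcu, mul_comm, mul_assoc, Units.mul_inv, mul_one]
    have h7 : P.natDegree = i := by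
      rw [h6, natDegree_C_mul hc.ne_zero, natDegree_pow, natDegree_X_sub_C, mul_one]
    refine ⟨?_, c, hc.ne_zero, by rw [h7]; exact h6⟩
    rw [← natDegree_pow, h4, natDegree_C_mul hc', natDegree_pow, natDegree_X_sub_C, mul_one]
  obtain ⟨M, hM⟩ := Nat.exists_eq_succ_of_ne_zero hP
  rw [Nat.succ_eq_add_one] at hM
  set lw : SymbolRing k := aeval w (X - C r) with hlw
  have hPw : aeval w P = c • lw ^ (M + 1) := by
    rw [hPc, hM, map_mul, aeval_C, map_pow, ← Algebra.smul_def]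
  have hP'w : aeval w (derivative P) = (c * (M + 1)) • lw ^ M := by
    have : derivative P = C (c * (M + 1)) * (X - C r) ^ M := by
      rw [hPc, hM, derivative_C_mul, derivative_X_sub_C_pow, C_mul, mul_assoc]
      simp
    rw [this, map_mul, aeval_C, map_pow, ← Algebra.smul_def]
  have hlw' : lw = w - algebraMap k _ r := by simp [hlw]
  have hgl : g = mon 0 A * lw ^ n := by rw [hg, map_pow]
  have hhdh : mon 1 0 * dh f = ((p : k) * (c * (M + 1))) • (mon 0 j * w * lw ^ M) := by
    rw [hf, dh_edge, hP'w, mul_left_comm, mul_left_comm (mon 1 0), h_mul_dh_mon, ← hw]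
    simp only [smul_mul_assoc, mul_smul_comm, smul_smul]
    congr 1
    ring
  have hex : ex f = (j : k) • (mon 0 j * (c • lw ^ (M + 1))) -
      ((q : k) * (c * (M + 1))) • (mon 0 j * w * lw ^ M) := by
    rw [hf, Derivation.leibniz, Derivation.map_aeval, ex_mon, ex_mon, hP'w, hPw, ← hw]
    simp only [smul_eq_mul, Algebra.smul_def]
    simp only [Int.cast_neg, Int.cast_natCast, map_mul, map_neg]
    ring
  have hkx : mon 1 0 * D (mon 0 1) =
      ((p : k) * (c * (M + 1))) • (mon 0 1 * (mon 0 j * w * lw ^ M)) := by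
    rw [hDb, bracket_x, ← mul_assoc, hhdh, smul_mul_assoc, mul_comm (mon 0 1)]
  -- The terms in `w` cancel by `n q = p + A` and `A (M + 1) = n j`; only a multiple of `r`
  -- survives.
  have hky : mon 1 0 * D (mon n (-1)) =
      ((A : k) * c * (M + 1) * r) • (mon n (-1) * (mon 0 j * lw ^ M)) := by
    have e1 : ((n : k) * q) = p + A := by exact_mod_cast hAeq
    have e2 : ((A : k) * (M + 1)) = n * j := by rw [hM] at hANeq; exact_mod_cast hANeq
    have e3 := congrArg (algebraMap k (SymbolRing k)) e1
    have e4 := congrArg (algebraMap k (SymbolRing k)) e2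
    have hdy := h_mul_dh_mon (k := k) n (-1)
    rw [hDb, bracket_apply, mul_sub, ← mul_assoc, hhdh, mul_left_comm (mon 1 0), hdy, hex, ex_mon]
    simp only [Algebra.smul_def, map_mul, map_add, map_one, Int.cast_neg, Int.cast_one, map_neg]
      at e3 e4 ⊢
    have hw' : w = lw + algebraMap k _ r := by rw [hlw']; ring
    rw [hw']
    linear_combination (algebraMap k (SymbolRing k) c * (algebraMap k (SymbolRing k) (M : k) + 1) *
      mon 0 j * (lw + algebraMap k _ r) * lw ^ M * mon n (-1)) * e3 +
      (algebraMap k (SymbolRing k) c * mon 0 j * lw ^ (M + 1) * mon n (-1)) * e4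
  have hM1 : (M + 1 : k) ≠ 0 := by exact_mod_cast M.succ_ne_zero
  have hDy : D (mon n (-1)) ≠ 0 := by
    intro h0
    rw [h0, mul_zero] at hky
    refine absurd hky.symm (smul_ne_zero ?_ (mul_ne_zero (mon_ne_zero _ _)
      (mul_ne_zero (mon_ne_zero _ _) (pow_ne_zero _ ?_))))
    · have : (A : k) ≠ 0 := by exact_mod_cast hApos.ne'
      exact mul_ne_zero (mul_ne_zero (mul_ne_zero this hc) hM1) hr0
    · rwa [hlw, Ne, map_eq_zero_iff _ hinj]
  have hxj : (mon 0 j * lw ^ M) ^ n = mon 0 A * g ^ M := by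
    have e : (A : ℤ) + M * A = n * j := by
      rw [hM] at hANeq
      have : (A : ℤ) * (M + 1) = n * j := by exact_mod_cast hANeq
      linarith
    rw [hgl, mul_pow, mul_pow, mon_pow, mon_pow, ← mul_assoc, mon_mul, e, ← pow_mul, ← pow_mul,
      mul_comm M n]
    simp
  have hywn : (mon 0 A * w ^ n : SymbolRing k) = mon n (-1) ^ p := by
    rw [hw, mon_pow, mon_mul, mon_pow]
    have e : (A : ℤ) + n * (-q) = p * (-1) := by
      have : (n : ℤ) * q = p + A := by exact_mod_cast hAeq
      linarith
    rw [e, zero_add, mul_comm]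
  -- After taking `n`-th powers, only powers of `x`, `y = h ^ n x⁻¹` and the kernel element `g`
  -- remain, so nilpotency degrees can be compared.
  have hkxn : (mon 1 0 * D (mon 0 1)) ^ n =
      ((p : k) * (c * (M + 1))) ^ n • (mon 0 1 ^ n * (mon n (-1) ^ p * g ^ M)) := by
    rw [hkx, _root_.smul_pow, ← hywn]
    congr 1
    rw [mul_pow, mul_right_comm (mon 0 (j : ℤ)), mul_pow (mon 0 (j : ℤ) * lw ^ M), hxj]
    ring
  have hkyn : (mon 1 0 * D (mon n (-1))) ^ n =
      ((A : k) * c * (M + 1) * r) ^ n • (mon n (-1) ^ n * (mon 0 1 ^ A * g ^ M)) := by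
    rw [hky, _root_.smul_pow, mul_pow (mon n (-1)), hxj]
    simp [mon_pow]
  obtain ⟨dH, hdH⟩ := hh.exists_hasNilDeg (mon_ne_zero _ _)
  obtain ⟨dX, hdX⟩ := hx.exists_hasNilDeg (mon_ne_zero _ _)
  obtain ⟨dY, hdY⟩ := hy.exists_hasNilDeg (mon_ne_zero _ _)
  obtain ⟨dX, rfl⟩ : ∃ d, dX = d + 1 := Nat.exists_eq_succ_of_ne_zero fun h0 => by
    subst h0
    exact hDx (hasNilDeg_zero_iff.1 hdX).2
  obtain ⟨dY, rfl⟩ : ∃ d, dY = d + 1 := Nat.exists_eq_succ_of_ne_zero fun h0 => by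
    subst h0
    exact hDy (hasNilDeg_zero_iff.1 hdY).2
  have hdg : HasNilDeg D g 0 := hasNilDeg_zero_iff.2 ⟨hgne, hDg⟩
  have hpk : (p : k) ≠ 0 := by exact_mod_cast hp.ne'
  have hAk : (A : k) ≠ 0 := by exact_mod_cast hApos.ne'
  have E1 : n * dH = (dX + 1) + (dY + 1) := by
    refine (hdH.pow hD n).unique ?_
    have : (mon 1 0 ^ n : SymbolRing k) = mon 0 1 * mon n (-1) := by simp [mon_pow, mon_mul]
    rw [this]
    exact hdX.mul hD hdY
  have E2 : n * (dH + dX) = n * (dX + 1) + (p * (dY + 1) + M * 0) := by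
    refine ((hdH.mul hD hdX.apply).pow hD n).unique ?_
    rw [hkxn]
    exact ((hdX.pow hD n).mul hD ((hdY.pow hD p).mul hD (hdg.pow hD M))).smul
      (pow_ne_zero _ (mul_ne_zero hpk (mul_ne_zero hc hM1)))
  have E3 : n * (dH + dY) = n * (dY + 1) + (A * (dX + 1) + M * 0) := by
    refine ((hdH.mul hD hdY.apply).pow hD n).unique ?_
    rw [hkyn]
    exact ((hdY.pow hD n).mul hD ((hdX.pow hD A).mul hD (hdg.pow hD M))).smul
      (pow_ne_zero _ (mul_ne_zero (mul_ne_zero (mul_ne_zero hAk hc) hM1) hr0))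
  -- With `N = deg P`, the bound `hj2` gives `n j + p N = n q N ≤ 2 n j`, whence `p N ≤ n j = A N`.
  have hpA : p ≤ A := by
    have h1 : n * q * P.natDegree = n * j + p * P.natDegree := by rw [hAeq, ← hANeq]; ring
    have h2 : p * P.natDegree ≤ A * P.natDegree := by
      rw [hANeq]
      nlinarith [Nat.mul_le_mul_left n hj2]
    exact Nat.le_of_mul_le_mul_right h2 (Nat.pos_of_ne_zero hP)
  -- Let `a`, `b` be the degrees of `x`, `y`. The three identities give `a + b - n = p b = A a`. If
  -- `p` and `A` were at least 2, adding would give `2 (a + b) ≤ 2 (a + b) - 2 n`.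
  have hp1 : p = 1 := by
    by_contra hne
    have hp2 : 2 ≤ p := by omega
    have h1 := Nat.mul_le_mul_right (dY + 1) hp2
    have h2 := Nat.mul_le_mul_right (dX + 1) (hp2.trans hpA)
    rw [mul_add] at E2 E3
    rw [mul_add n, mul_one] at E2 E3
    omega
  refine ⟨hp1, ?_, c, r, hc, hr0, hPc⟩
  rw [hAeq, ← hANeq, hp1]
  ring

end Edge

end SymbolRing

/-! ### Shifts, the star product and coefficients of powers of `x` -/

namespace SymbolRing

section Star

variable {k : Type*} [Field k]

/-- The substitution `h ↦ u`, `x ↦ x`. -/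
noncomputable def subst (u : SymbolRing k) : SymbolRing k →ₐ[k] SymbolRing k :=
  AddMonoidAlgebra.lift k (SymbolRing k) (ℕ × ℤ)
    { toFun := fun m => u ^ m.toAdd.1 * mon 0 m.toAdd.2
      map_one' := by simp [mon_zero]
      map_mul' := fun m m' => by
        simp only [toAdd_mul, Prod.fst_add, Prod.snd_add, pow_add]
        rw [← zero_add (0 : ℕ), ← mon_mul, zero_add]
        ring }

theorem subst_mon (u : SymbolRing k) (i : ℕ) (l : ℤ) : subst u (mon i l) = u ^ i * mon 0 l := by
  rw [subst, mon, AddMonoidAlgebra.lift_single]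
  simp

theorem mon_eq (i : ℕ) (l : ℤ) : (mon i l : SymbolRing k) = mon 1 0 ^ i * mon 0 l := by
  simp [mon_pow, mon_mul]

theorem algHom_ext_mon {S T : SymbolRing k →ₐ[k] SymbolRing k}
    (h : S (mon 1 0) = T (mon 1 0)) (h' : ∀ l, S (mon 0 l) = T (mon 0 l)) : S = T := by
  refine AlgHom.toLinearMap_injective (lin_ext fun i l => ?_)
  rw [mon_eq]
  simp [h, h']

/-- The shift `h ↦ h - c`. -/
noncomputable def shift (c : k) : SymbolRing k →ₐ[k] SymbolRing k :=
  subst (mon 1 0 - algebraMap k _ c)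

theorem shift_mon (c : k) (i : ℕ) (l : ℤ) :
    shift c (mon i l) = (mon 1 0 - algebraMap k _ c) ^ i * mon 0 l := subst_mon _ i l

theorem shift_mon_zero (c : k) (l : ℤ) : shift c (mon 0 l) = mon 0 l := by
  simp [shift_mon]

theorem shift_h (c : k) : shift c (mon 1 0) = mon 1 0 - algebraMap k _ c := by
  simp [shift_mon, mon_zero]

theorem shift_comp (c d : k) : (shift c).comp (shift d) = shift (c + d) := by
  refine algHom_ext_mon ?_ fun l => by simp [shift_mon_zero]
  simp only [AlgHom.comp_apply, shift_h, map_sub, AlgHom.commutes, map_add]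
  ring

theorem shift_shift (c d : k) (f : SymbolRing k) : shift c (shift d f) = shift (c + d) f := by
  rw [← shift_comp]; rfl

theorem shift_zero (f : SymbolRing k) : shift 0 f = f := by
  have : shift (0 : k) = AlgHom.id k _ :=
    algHom_ext_mon (by simp [shift_h]) fun l => by simp [shift_mon_zero]
  rw [this]; rfl

theorem shift_aeval (c : k) (r : k[X]) :
    shift c (aeval (mon 1 0) r) = aeval (mon 1 0) (r.comp (X - C c)) := by
  rw [← aeval_algHom_apply, shift_h, aeval_comp]
  simp

/-- The product of symbols induced by the rule `x * g(h) = g(h - 1) * x`. -/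
noncomputable def star : SymbolRing k →ₗ[k] SymbolRing k →ₗ[k] SymbolRing k :=
  linOfMon fun i l => LinearMap.mulLeft k (mon i l) ∘ₗ (shift (l : k)).toLinearMap

theorem star_mon (i : ℕ) (l : ℤ) (g : SymbolRing k) :
    star (mon i l) g = mon i l * shift (l : k) g := by
  rw [star, linOfMon_mon]; rfl

theorem star_aeval_mul (r : k[X]) (l : ℤ) (g : SymbolRing k) :
    star (aeval (mon 1 0) r * mon 0 l) g = aeval (mon 1 0) r * mon 0 l * shift (l : k) g := by
  induction r using Polynomial.induction_on' with
  | add P Q hP hQ => simp only [map_add, add_mul, LinearMap.add_apply, hP, hQ]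
  | monomial s c =>
    rw [aeval_monomial, ← Algebra.smul_def, smul_mul_assoc, ← mon_eq, map_smul,
      LinearMap.smul_apply, star_mon, smul_mul_assoc]

/-- The coefficient of `x ^ l`, a polynomial in `h`. -/
noncomputable def slice (l : ℤ) : SymbolRing k →ₗ[k] k[X] :=
  linOfMon fun i l' => if l' = l then X ^ i else 0

theorem coeff_slice (l : ℤ) (f : SymbolRing k) (i : ℕ) :
    (slice l f).coeff i = f.coeff (i, l) := by
  have : lcoeff k i ∘ₗ slice l =
      Finsupp.lapply (i, l) ∘ₗ (AddMonoidAlgebra.coeffLinearEquiv k).toLinearMap := by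
    refine lin_ext fun i' l' => ?_
    simp only [LinearMap.comp_apply, slice, linOfMon_mon, lcoeff_apply]
    change _ = (mon i' l' : SymbolRing k).coeff (i, l)
    rw [coeff_mon]
    by_cases h : l' = l
    · simp [h, coeff_X_pow, eq_comm]
    · simp [h]
  exact LinearMap.congr_fun this f

theorem slice_aeval_mul (r : k[X]) (l l' : ℤ) :
    slice l (aeval (mon 1 0) r * mon 0 l' : SymbolRing k) = if l' = l then r else 0 := by
  induction r using Polynomial.induction_on' with
  | add P Q hP hQ =>
    simp only [map_add, add_mul, hP, hQ]
    split_ifs <;> simp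
  | monomial s c =>
    rw [aeval_monomial, ← Algebra.smul_def, smul_mul_assoc, ← mon_eq, map_smul, slice,
      linOfMon_mon]
    split_ifs <;> simp [smul_eq_C_mul, C_mul_X_pow_eq_monomial]

end Star

end SymbolRing

/-! ### Generators, universal property and spanning normal form -/

/-- The generalized Weyl algebra `k[h](σ_cl, a)`. -/
abbrev ClassicalGWA {k : Type*} [Field k] (a : k[X]) := GWA (sigmaCl k) a

namespace ClassicalGWA

section Generators

variable {k : Type*} [Field k]

theorem sigmaCl_apply (p : k[X]) : sigmaCl k p = p.comp (X - 1) := by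
  rw [sigmaCl, algEquivOfCompEqX_apply, comp_eq_aeval]

theorem sigmaCl_symm_X : (sigmaCl k).symm X = (X + 1 : k[X]) := by
  rw [AlgEquiv.symm_apply_eq, sigmaCl_apply]
  simp

variable (a : k[X])

/-- The generator `h`. -/
noncomputable def genH : ClassicalGWA a :=
  RingQuot.mkAlgHom k _ (FreeAlgebra.ι k GWAGen.h)

/-- The generator `x`. -/
noncomputable def genX : ClassicalGWA a :=
  RingQuot.mkAlgHom k _ (FreeAlgebra.ι k GWAGen.x)

/-- The generator `y`. -/
noncomputable def genY : ClassicalGWA a :=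
  RingQuot.mkAlgHom k _ (FreeAlgebra.ι k GWAGen.y)

theorem mkAlgHom_poly (p : k[X]) :
    RingQuot.mkAlgHom k (GWARel (sigmaCl k) a) (GWAGen.poly p) = aeval (genH a) p := by
  rw [GWAGen.poly, ← aeval_algHom_apply]; rfl

theorem genX_mul_genH : genX a * genH a = (genH a - 1) * genX a := by
  have := RingQuot.mkAlgHom_rel k (GWARel.x_h (σ := sigmaCl k) (a := a))
  rw [map_mul, map_mul, mkAlgHom_poly, sigmaCl_X, map_sub, map_one, aeval_X] at this
  exact this

theorem genY_mul_genH : genY a * genH a = (genH a + 1) * genY a := by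
  have := RingQuot.mkAlgHom_rel k (GWARel.y_h (σ := sigmaCl k) (a := a))
  rw [map_mul, map_mul, mkAlgHom_poly, sigmaCl_symm_X, map_add, map_one, aeval_X] at this
  exact this

theorem genX_mul_genY : genX a * genY a = aeval (genH a - 1) a := by
  have := RingQuot.mkAlgHom_rel k (GWARel.x_y (σ := sigmaCl k) (a := a))
  rw [map_mul, mkAlgHom_poly, sigmaCl_apply, aeval_comp, map_sub, map_one, aeval_X] at this
  exact this

theorem genY_mul_genX : genY a * genX a = aeval (genH a) a := by
  have := RingQuot.mkAlgHom_rel k (GWARel.y_x (σ := sigmaCl k) (a := a))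
  rwa [map_mul, mkAlgHom_poly] at this

variable {a}

/-- The universal property of `k[h](σ_cl, a)`. -/
noncomputable def lift {S : Type*} [Ring S] [Algebra k S] (H U V : S)
    (h₁ : U * H = (H - 1) * U) (h₂ : V * H = (H + 1) * V) (h₃ : U * V = aeval (H - 1) a)
    (h₄ : V * U = aeval H a) : ClassicalGWA a →ₐ[k] S :=
  RingQuot.liftAlgHom k
    ⟨FreeAlgebra.lift k fun g => match g with
      | GWAGen.h => H
      | GWAGen.x => U
      | GWAGen.y => V, by
      intro b c hbc
      have hp : ∀ p : k[X], FreeAlgebra.lift k (fun g => match g with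
          | GWAGen.h => H
          | GWAGen.x => U
          | GWAGen.y => V) (GWAGen.poly p) = aeval H p := fun p => by
        rw [GWAGen.poly, ← aeval_algHom_apply, FreeAlgebra.lift_ι_apply]
      cases hbc with
      | x_h => rw [map_mul, map_mul, hp, sigmaCl_X]; simpa using h₁
      | y_h => rw [map_mul, map_mul, hp, sigmaCl_symm_X]; simpa using h₂
      | x_y => rw [map_mul, hp, sigmaCl_apply, aeval_comp]; simpa using h₃
      | y_x => rw [map_mul, hp]; simpa using h₄⟩

section Lift

variable {S : Type*} [Ring S] [Algebra k S] {H U V : S}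
  (h₁ : U * H = (H - 1) * U) (h₂ : V * H = (H + 1) * V) (h₃ : U * V = aeval (H - 1) a)
  (h₄ : V * U = aeval H a)

theorem lift_genH : lift H U V h₁ h₂ h₃ h₄ (genH a) = H := by
  rw [lift, genH, RingQuot.liftAlgHom_mkAlgHom_apply, FreeAlgebra.lift_ι_apply]

theorem lift_genX : lift H U V h₁ h₂ h₃ h₄ (genX a) = U := by
  rw [lift, genX, RingQuot.liftAlgHom_mkAlgHom_apply, FreeAlgebra.lift_ι_apply]

theorem lift_genY : lift H U V h₁ h₂ h₃ h₄ (genY a) = V := by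
  rw [lift, genY, RingQuot.liftAlgHom_mkAlgHom_apply, FreeAlgebra.lift_ι_apply]

end Lift

theorem adjoin_gen : Algebra.adjoin k {genH a, genX a, genY a} = ⊤ := by
  rw [eq_top_iff]
  rintro b -
  obtain ⟨c, rfl⟩ := RingQuot.mkAlgHom_surjective k _ b
  induction c using FreeAlgebra.induction with
  | grade0 r => rw [AlgHom.commutes]; exact Subalgebra.algebraMap_mem _ r
  | grade1 g => cases g <;> exact Algebra.subset_adjoin (by simp [genH, genX, genY])
  | mul b c hb hc => rw [map_mul]; exact mul_mem hb hc
  | add b c hb hc => rw [map_add]; exact add_mem hb hc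

theorem algHom_ext {S : Type*} [Ring S] [Algebra k S] {F G : ClassicalGWA a →ₐ[k] S}
    (hH : F (genH a) = G (genH a)) (hX : F (genX a) = G (genX a))
    (hY : F (genY a) = G (genY a)) : F = G := by
  refine AlgHom.ext_of_adjoin_eq_top adjoin_gen ?_
  rintro b (rfl | rfl | rfl) <;> assumption

/-- A subspace containing `1` and stable under left multiplication by the generators is
everything. -/
theorem submodule_eq_top (M : Submodule k (ClassicalGWA a)) (h1 : 1 ∈ M)
    (hH : ∀ b ∈ M, genH a * b ∈ M) (hX : ∀ b ∈ M, genX a * b ∈ M)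
    (hY : ∀ b ∈ M, genY a * b ∈ M) : M = ⊤ := by
  let T : Subalgebra k (ClassicalGWA a) :=
    { carrier := {c | ∀ b ∈ M, c * b ∈ M}
      mul_mem' := fun {c d} hc hd b hb => by rw [mul_assoc]; exact hc _ (hd b hb)
      add_mem' := fun {c d} hc hd b hb => by rw [add_mul]; exact add_mem (hc b hb) (hd b hb)
      algebraMap_mem' := fun r b hb => by
        rw [← Algebra.smul_def]; exact M.smul_mem r hb }
  have hT : T = ⊤ := by
    rw [eq_top_iff, ← adjoin_gen, Algebra.adjoin_le_iff]
    rintro b (rfl | rfl | rfl)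
    · exact hH
    · exact hX
    · exact hY
  rw [eq_top_iff]
  rintro b -
  have hb : b ∈ T := hT ▸ Algebra.mem_top
  simpa using hb 1 h1

variable (a) in
/-- The homogeneous generator of degree `l`: a power of `x` or a power of `y`. -/
noncomputable def gen : ℤ → ClassicalGWA a
  | Int.ofNat m => genX a ^ m
  | Int.negSucc m => genY a ^ (m + 1)

theorem gen_natCast (m : ℕ) : gen a m = genX a ^ m := rfl

theorem gen_neg_natCast (m : ℕ) : gen a (-m) = genY a ^ m := by
  rcases m with _ | m
  · simp [show gen a 0 = genX a ^ 0 from rfl]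
  · rfl

theorem mul_aeval_of_comm {S : Type*} [Ring S] [Algebra k S] {U H H' : S} (h : U * H = H' * U)
    (r : k[X]) : U * aeval H r = aeval H' r * U := by
  induction r using Polynomial.induction_on' with
  | add P Q hP hQ => simp only [map_add, mul_add, add_mul, hP, hQ]
  | monomial s c =>
    have : U * H ^ s = H' ^ s * U := by
      have : SemiconjBy U H H' := h
      exact this.pow_right s
    rw [aeval_monomial, aeval_monomial, mul_assoc, ← this, ← mul_assoc, ← mul_assoc,
      Algebra.commutes]

theorem aeval_comp_sub_one {S : Type*} [Ring S] [Algebra k S] (H : S) (r : k[X]) :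
    aeval H (r.comp (X - 1)) = aeval (H - 1) r := by
  rw [aeval_comp]; simp

theorem aeval_comp_add_one {S : Type*} [Ring S] [Algebra k S] (H : S) (r : k[X]) :
    aeval H (r.comp (X + 1)) = aeval (H + 1) r := by
  rw [aeval_comp]; simp

/-- Every element is a sum of elements `r(h) x ^ m` and `r(h) y ^ m`. -/
theorem span_gen : Submodule.span k
    (Set.range fun rl : k[X] × ℤ => aeval (genH a) rl.1 * gen a rl.2) = ⊤ := by
  set M := Submodule.span k (Set.range fun rl : k[X] × ℤ => aeval (genH a) rl.1 * gen a rl.2)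
  have hmem : ∀ (r : k[X]) (l : ℤ), aeval (genH a) r * gen a l ∈ M := fun r l =>
    Submodule.subset_span ⟨(r, l), rfl⟩
  have hstable : ∀ c : ClassicalGWA a, (∀ (r : k[X]) (l : ℤ), c * (aeval (genH a) r * gen a l) ∈ M) →
      ∀ b ∈ M, c * b ∈ M := by
    intro c hc b hb
    have : M ≤ M.comap (LinearMap.mulLeft k c) := by
      rw [Submodule.span_le]
      rintro _ ⟨rl, rfl⟩
      exact hc rl.1 rl.2
    exact this hb
  refine submodule_eq_top M ?_ (hstable _ fun r l => ?_) (hstable _ fun r l => ?_)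
    (hstable _ fun r l => ?_)
  · simpa [show gen a 0 = genX a ^ 0 from rfl] using hmem 1 0
  · have := hmem (X * r) l
    rwa [map_mul, aeval_X, mul_assoc] at this
  · rw [← mul_assoc, mul_aeval_of_comm (genX_mul_genH a), ← aeval_comp_sub_one, mul_assoc]
    rcases l with m | m
    · have : genX a * gen a (Int.ofNat m) = gen a (Int.ofNat (m + 1)) := (pow_succ' _ _).symm
      rw [this]; exact hmem _ _
    · have : genX a * gen a (Int.negSucc m) = aeval (genH a) (a.comp (X - 1)) * gen a (-m) := by
        rw [gen_neg_natCast, gen, pow_succ', ← mul_assoc, genX_mul_genY, aeval_comp_sub_one]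
      rw [this, ← mul_assoc, ← map_mul]; exact hmem _ _
  · rw [← mul_assoc, mul_aeval_of_comm (genY_mul_genH a), ← aeval_comp_add_one, mul_assoc]
    rcases l with m | m
    · rcases m with _ | m
      · have : genY a * gen a (Int.ofNat 0) = gen a (-(1 : ℕ)) := by
          rw [gen_neg_natCast, gen]; simp
        rw [this]; exact hmem _ _
      · have : genY a * gen a (Int.ofNat (m + 1)) = aeval (genH a) a * gen a (Int.ofNat m) := by
          rw [gen, gen, pow_succ', ← mul_assoc, genY_mul_genX]
        rw [this, ← mul_assoc, ← map_mul]; exact hmem _ _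
    · have : genY a * gen a (Int.negSucc m) = gen a (Int.negSucc (m + 1)) := (pow_succ' _ _).symm
      rw [this]; exact hmem _ _

theorem exists_normalForm (b : ClassicalGWA a) :
    ∃ f : ℤ →₀ k[X], b = f.sum fun l r => aeval (genH a) r * gen a l := by
  have hb : b ∈ Submodule.span k
      (Set.range fun rl : k[X] × ℤ => aeval (genH a) rl.1 * gen a rl.2) := by
    rw [span_gen]; trivial
  induction hb using Submodule.span_induction with
  | mem b hb =>
    obtain ⟨⟨r, l⟩, rfl⟩ := hb
    exact ⟨Finsupp.single l r, by simp⟩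
  | zero => exact ⟨0, by simp⟩
  | add b c _ _ hb hc =>
    obtain ⟨f, rfl⟩ := hb
    obtain ⟨g, rfl⟩ := hc
    refine ⟨f + g, ?_⟩
    rw [Finsupp.sum_add_index'] <;> intros <;> simp [add_mul]
  | smul s b _ hb =>
    obtain ⟨f, rfl⟩ := hb
    refine ⟨s • f, ?_⟩
    rw [Finsupp.sum_smul_index' (by simp), Finsupp.smul_sum]
    simp

end Generators

end ClassicalGWA

/-! ### The action on symbols and injectivity of the symbol map -/

namespace ClassicalGWA

open SymbolRing

section Symbol

variable {k : Type*} [Field k] (a : k[X])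

/-- Multiplication by `f`, as an operator on the symbol ring. -/
noncomputable abbrev mulOp (f : SymbolRing k) : Module.End k (SymbolRing k) :=
  Algebra.lmul k (SymbolRing k) f

theorem mulOp_apply (f g : SymbolRing k) : mulOp f g = f * g := rfl

theorem mon_zero_add (l l' : ℤ) : (mon 0 (l + l') : SymbolRing k) = mon 0 l * mon 0 l' := by
  rw [mon_mul]

/-- The operator by which `x` acts on symbols. -/
noncomputable def opX : Module.End k (SymbolRing k) := mulOp (mon 0 1) * (shift 1).toLinearMap

/-- The inverse of `opX`. -/
noncomputable def opXinv : Module.End k (SymbolRing k) :=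
  mulOp (mon 0 (-1)) * (shift (-1)).toLinearMap

theorem opX_apply (f : SymbolRing k) : opX f = mon 0 1 * shift 1 f := rfl

theorem opXinv_apply (f : SymbolRing k) : opXinv f = mon 0 (-1) * shift (-1) f := rfl

theorem opX_mul_opXinv : (opX * opXinv : Module.End k (SymbolRing k)) = 1 := by
  refine LinearMap.ext fun f => ?_
  rw [Module.End.mul_apply, opX_apply, opXinv_apply, map_mul, shift_shift, shift_mon_zero,
    ← mul_assoc, mon_mul]
  simp [shift_zero, mon_zero]

theorem opXinv_mul_opX : (opXinv * opX : Module.End k (SymbolRing k)) = 1 := by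
  refine LinearMap.ext fun f => ?_
  rw [Module.End.mul_apply, opX_apply, opXinv_apply, map_mul, shift_shift, shift_mon_zero,
    ← mul_assoc, mon_mul]
  simp [shift_zero, mon_zero]

theorem eq_of_mul_opX {S T : Module.End k (SymbolRing k)} (h : S * opX = T * opX) : S = T := by
  rw [← mul_one S, ← mul_one T, ← opX_mul_opXinv, ← mul_assoc, h, mul_assoc]

theorem opX_mul_mulOp_h : (opX * mulOp (mon 1 0) : Module.End k (SymbolRing k)) =
    (mulOp (mon 1 0) - 1) * opX := by
  refine LinearMap.ext fun f => ?_
  rw [Module.End.mul_apply, Module.End.mul_apply, LinearMap.sub_apply, Module.End.one_apply,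
    mulOp_apply, mulOp_apply, opX_apply, opX_apply, map_mul, shift_h, map_one]
  ring

theorem opXinv_mul_of {M : Module.End k (SymbolRing k)} (h : opX * M = (M - 1) * opX) :
    opXinv * M = (M + 1) * opXinv := by
  apply eq_of_mul_opX
  have h' : M * opX = opX * (M + 1) := by
    rw [mul_add, h, sub_mul, one_mul, mul_one, sub_add_cancel]
  rw [mul_assoc, h', ← mul_assoc, opXinv_mul_opX, one_mul, mul_assoc, opXinv_mul_opX, mul_one]

/-- The homomorphism to operators given by an operator `M` playing the role of `h`. -/
noncomputable def opLift (M : Module.End k (SymbolRing k)) (h : opX * M = (M - 1) * opX) :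
    ClassicalGWA a →ₐ[k] Module.End k (SymbolRing k) :=
  lift M opX (aeval M a * opXinv) h
    (by
      rw [mul_assoc, opXinv_mul_of h, ← mul_assoc, mul_add, ← mul_aeval_of_comm (U := M) rfl,
        mul_one, add_mul, add_mul, one_mul, mul_assoc])
    (by rw [← mul_assoc, mul_aeval_of_comm h, mul_assoc, opX_mul_opXinv, mul_one])
    (by rw [mul_assoc, opXinv_mul_opX, mul_one])

variable {a} in
theorem opLift_gen {M : Module.End k (SymbolRing k)} (h : opX * M = (M - 1) * opX) :
    opLift a M h (genH a) = M ∧ opLift a M h (genX a) = opX ∧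
      opLift a M h (genY a) = aeval M a * opXinv := by
  rw [opLift]
  exact ⟨lift_genH .., lift_genX .., lift_genY ..⟩

/-- The action on the symbol ring. -/
noncomputable def rep : ClassicalGWA a →ₐ[k] Module.End k (SymbolRing k) :=
  opLift a (mulOp (mon 1 0)) opX_mul_mulOp_h

/-- The symbol of an element, obtained by acting on `1`. -/
noncomputable def sym : ClassicalGWA a →ₗ[k] SymbolRing k :=
  LinearMap.applyₗ 1 ∘ₗ (rep a).toLinearMap

variable {a}

theorem aeval_mulOp (f : SymbolRing k) (r : k[X]) : aeval (mulOp f) r = mulOp (aeval f r) :=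
  aeval_algHom_apply _ _ _

theorem rep_genH : rep a (genH a) = mulOp (mon 1 0) := (opLift_gen _).1

theorem rep_genX : rep a (genX a) = opX := (opLift_gen _).2.1

theorem rep_genY : rep a (genY a) = mulOp (aeval (mon 1 0) a) * opXinv := by
  rw [← aeval_mulOp]; exact (opLift_gen _).2.2

theorem sym_apply (b : ClassicalGWA a) : sym a b = rep a b 1 := rfl

theorem sym_one : sym a 1 = 1 := by
  rw [sym_apply, map_one (rep a)]; rfl

theorem sym_mul' (b c : ClassicalGWA a) : sym a (b * c) = rep a b (sym a c) := by
  rw [sym_apply, map_mul]; rfl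

theorem sym_genH_mul (b : ClassicalGWA a) : sym a (genH a * b) = mon 1 0 * sym a b := by
  rw [sym_mul', rep_genH]; rfl

theorem sym_genX_mul (b : ClassicalGWA a) : sym a (genX a * b) = mon 0 1 * shift 1 (sym a b) := by
  rw [sym_mul', rep_genX]; rfl

theorem sym_genY_mul (b : ClassicalGWA a) : sym a (genY a * b) =
    aeval (mon 1 0) a * mon 0 (-1) * shift (-1) (sym a b) := by
  rw [sym_mul', rep_genY, mul_assoc]; rfl

theorem sym_aeval_mul (r : k[X]) (b : ClassicalGWA a) :
    sym a (aeval (genH a) r * b) = aeval (mon 1 0) r * sym a b := by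
  rw [sym_mul', ← aeval_algHom_apply, rep_genH, aeval_mulOp]; rfl

/-- This identifies the star product with the transported multiplication. The check on generators
suffices, and no associativity of `star` has to be proved by hand. -/
theorem rep_apply (b : ClassicalGWA a) (g : SymbolRing k) : rep a b g = star (sym a b) g := by
  suffices h : LinearMap.eqLocus (rep a).toLinearMap (star ∘ₗ sym a) = ⊤ by
    have hb : b ∈ LinearMap.eqLocus (rep a).toLinearMap (star ∘ₗ sym a) := h ▸ Submodule.mem_top
    exact LinearMap.congr_fun hb g
  have hmem : ∀ b, b ∈ LinearMap.eqLocus (rep a).toLinearMap (star ∘ₗ sym a) ↔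
      ∀ g, rep a b g = star (sym a b) g := fun b => LinearMap.ext_iff
  refine submodule_eq_top _ ?_ ?_ ?_ ?_
  · rw [hmem]
    intro g
    rw [sym_one, map_one, ← mon_zero, star_mon, mon_zero]
    simp [shift_zero]
  · intro b hb
    rw [hmem] at hb ⊢
    intro g
    rw [map_mul, Module.End.mul_apply, hb, rep_genH, sym_genH_mul]
    generalize sym a b = f
    have : LinearMap.mulLeft k (mon 1 0) ∘ₗ star.flip g =
        star.flip g ∘ₗ LinearMap.mulLeft k (mon 1 0) := by
      refine lin_ext fun i l => ?_
      simp [star_mon, mon_mul, ← mul_assoc]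
    exact LinearMap.congr_fun this f
  · intro b hb
    rw [hmem] at hb ⊢
    intro g
    rw [map_mul, Module.End.mul_apply, hb, rep_genX, sym_genX_mul]
    generalize sym a b = f
    have : opX ∘ₗ star.flip g = star.flip g ∘ₗ opX := by
      refine lin_ext fun i l => ?_
      have e : opX (mon i l : SymbolRing k) = aeval (mon 1 0) ((X - 1 : k[X]) ^ i) * mon 0 (1 + l) := by
        rw [opX_apply, shift_mon, mul_left_comm, mon_mul]
        simp only [map_pow, map_sub, aeval_X, map_one, add_zero]
      rw [LinearMap.comp_apply, LinearMap.comp_apply, e, LinearMap.flip_apply,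
        LinearMap.flip_apply, star_aeval_mul, star_mon, opX_apply, map_mul, shift_shift, shift_mon, mon_zero_add]
      simp only [map_pow, map_sub, aeval_X, map_one, Int.cast_add, Int.cast_one]
      ring
    exact LinearMap.congr_fun this f
  · intro b hb
    rw [hmem] at hb ⊢
    intro g
    rw [map_mul, Module.End.mul_apply, hb, rep_genY, sym_genY_mul]
    generalize sym a b = f
    have : mulOp (aeval (mon 1 0) a) ∘ₗ opXinv ∘ₗ star.flip g =
        star.flip g ∘ₗ mulOp (aeval (mon 1 0) a) ∘ₗ opXinv := by
      refine lin_ext fun i l => ?_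
      have e : aeval (mon 1 0) a * opXinv (mon i l : SymbolRing k) =
          aeval (mon 1 0) (a * (X + 1) ^ i) * mon 0 (-1 + l) := by
        rw [opXinv_apply, shift_mon, mon_zero_add]
        simp only [map_mul, map_pow, map_add, aeval_X, map_one, map_neg]
        ring
      rw [LinearMap.comp_apply, LinearMap.comp_apply, LinearMap.comp_apply, LinearMap.comp_apply,
        mulOp_apply, mulOp_apply, e, LinearMap.flip_apply, LinearMap.flip_apply, star_aeval_mul, star_mon, opXinv_apply,
        map_mul, shift_shift, shift_mon, mon_zero_add]
      simp only [map_mul, map_pow, map_add, map_neg, aeval_X, map_one, Int.cast_add,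
        Int.cast_one, Int.cast_neg, sub_neg_eq_add]
      ring
    have h2 := LinearMap.congr_fun this f
    simp only [LinearMap.comp_apply, LinearMap.flip_apply, mulOp_apply] at h2
    rw [Module.End.mul_apply, mulOp_apply, h2, mul_assoc, opXinv_apply]

theorem sym_mul (b c : ClassicalGWA a) : sym a (b * c) = star (sym a b) (sym a c) := by
  rw [sym_mul', rep_apply]

theorem sym_mul_genX (b : ClassicalGWA a) : sym a (b * genX a) = sym a b * mon 0 1 := by
  have hx : sym a (genX a) = mon 0 1 := by
    rw [← mul_one (genX a), sym_genX_mul, sym_one, map_one, mul_one]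
  rw [sym_mul, hx]
  generalize sym a b = f
  have : star.flip (mon 0 1) = LinearMap.mulRight k (mon 0 1 : SymbolRing k) := by
    refine lin_ext fun i l => ?_
    rw [LinearMap.flip_apply, star_mon, shift_mon_zero]; rfl
  exact LinearMap.congr_fun this f

variable (a) in
/-- The symbol of `gen a l` is `genSym a l * x ^ l`. -/
noncomputable def genSym : ℤ → k[X]
  | Int.ofNat _ => 1
  | Int.negSucc m => Nat.rec a (fun _ r => a * r.comp (X + 1)) m

theorem sym_gen (l : ℤ) : sym a (gen a l) = aeval (mon 1 0) (genSym a l) * mon 0 l := by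
  rcases l with m | m
  · simp only [gen, genSym, map_one, one_mul]
    induction m with
    | zero => rw [pow_zero, sym_one]; rfl
    | succ m ih =>
      rw [pow_succ', sym_genX_mul, ih, shift_mon_zero, mon_mul]
      congr 1
      simp [add_comm]
  · induction m with
    | zero =>
      rw [gen, pow_succ', pow_zero, sym_genY_mul, sym_one, map_one, mul_one]
      rfl
    | succ m ih =>
      rw [gen, pow_succ', sym_genY_mul]
      have h1 : genY a ^ (m + 1) = gen a (Int.negSucc m) := rfl
      have h2 : genSym a (Int.negSucc (m + 1)) =
        a * (genSym a (Int.negSucc m)).comp (X + 1) := rfl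
      have h3 : (Int.negSucc (m + 1)) = -1 + Int.negSucc m := by omega
      rw [h1, ih, h2, h3, map_mul, shift_aeval, shift_mon_zero, mon_zero_add, map_mul]
      simp
      ring

theorem genSym_natCast (m : ℕ) : genSym a m = 1 := rfl

theorem genSym_ne_zero_and_natDegree (ha : a ≠ 0) (m : ℕ) :
    genSym a (Int.negSucc m) ≠ 0 ∧
      (genSym a (Int.negSucc m)).natDegree = a.natDegree * (m + 1) := by
  induction m with
  | zero => simpa [genSym] using ha
  | succ m ih =>
    have h2 : genSym a (Int.negSucc (m + 1)) =
      a * (genSym a (Int.negSucc m)).comp (X + 1) := rfl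
    have h3 : (genSym a (Int.negSucc m)).comp (X + C 1) ≠ 0 := by
      rw [Ne, comp_X_add_C_eq_zero_iff]; exact ih.1
    rw [C_1] at h3
    rw [h2]
    refine ⟨mul_ne_zero ha h3, ?_⟩
    rw [natDegree_mul ha h3, natDegree_comp, ih.2, ← C_1, natDegree_X_add_C]
    ring

theorem genSym_ne_zero (ha : a ≠ 0) (l : ℤ) : genSym a l ≠ 0 := by
  rcases l with m | m
  · exact one_ne_zero
  · exact (genSym_ne_zero_and_natDegree ha m).1

theorem slice_sym_sum (f : ℤ →₀ k[X]) (l : ℤ) :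
    slice l (sym a (f.sum fun l r => aeval (genH a) r * gen a l)) = f l * genSym a l := by
  classical
  rw [Finsupp.sum, map_sum, map_sum, Finset.sum_eq_single l]
  · rw [sym_aeval_mul, sym_gen, ← mul_assoc, ← map_mul, slice_aeval_mul, if_pos rfl]
  · intro l' _ hne
    rw [sym_aeval_mul, sym_gen, ← mul_assoc, ← map_mul, slice_aeval_mul, if_neg hne]
  · intro h
    simp [Finsupp.notMem_support_iff.1 h]

/-- The coefficient of `x ^ (-m)` is a multiple of `a(h) a(h + 1) ⋯ a(h + m - 1)`. This confines
symbols to a cone, and makes negative coefficients of small degree vanish. -/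
theorem genSym_dvd_slice (b : ClassicalGWA a) (l : ℤ) : genSym a l ∣ slice l (sym a b) := by
  obtain ⟨f, rfl⟩ := exists_normalForm b
  rw [slice_sym_sum]
  exact dvd_mul_left _ _

theorem sym_injective (ha : a ≠ 0) : Function.Injective (sym a) := by
  rw [injective_iff_map_eq_zero]
  intro b hb
  obtain ⟨f, rfl⟩ := exists_normalForm b
  have : f = 0 := by
    ext1 l
    have h1 := slice_sym_sum (a := a) f l
    rw [hb, map_zero, eq_comm, mul_eq_zero] at h1
    exact h1.resolve_right (genSym_ne_zero ha l)
  simp [this]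

/-- On symbols, right multiplication by `x` is ordinary multiplication by `x`. Identities involving
`y` can therefore be checked after multiplying by `x`. -/
theorem mul_genX_injective (ha : a ≠ 0) {b c : ClassicalGWA a} (h : b * genX a = c * genX a) :
    b = c := by
  apply sym_injective ha
  apply mul_right_cancel₀ (mon_ne_zero (k := k) 0 1)
  rw [← sym_mul_genX, h, sym_mul_genX]

end Symbol

end ClassicalGWA

/-! ### Weight filtrations: the bracket as leading part of the commutator -/

namespace SymbolRing

section Filtration

variable {k : Type*} [Field k] {q p W V : ℤ}

/-- Elements whose monomials have weight at most `W`, where `h` has weight `q` and `x` has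
weight `p`. -/
noncomputable def fil (k : Type*) [Field k] (q p W : ℤ) : Submodule k (SymbolRing k) :=
  supp fun i l => q * i + p * l ≤ W

/-- Elements whose monomials all have weight `W`. -/
noncomputable def homog (k : Type*) [Field k] (q p W : ℤ) : Submodule k (SymbolRing k) :=
  supp fun i l => q * i + p * l = W

theorem aeval_mul_mon_mem_supp {P : ℕ → ℤ → Prop} (r : k[X]) {l : ℤ} (h : ∀ i, P i l) :
    aeval (mon 1 0) r * mon 0 l ∈ (supp P : Submodule k (SymbolRing k)) := by
  rw [aeval_eq_sum_range, Finset.sum_mul]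
  refine sum_mem fun t _ => ?_
  rw [smul_mul_assoc, ← mon_eq]
  exact Submodule.smul_mem _ _ (mon_mem_supp (h t))

theorem mem_fil_of_eq {f : SymbolRing k} (h : f ∈ fil k q p W) (e : W = V) :
    f ∈ fil k q p V := e ▸ h

theorem mem_homog_of_eq {f : SymbolRing k} (h : f ∈ homog k q p W) (e : W = V) :
    f ∈ homog k q p V := e ▸ h

theorem fil_mono (h : W ≤ V) : fil k q p W ≤ fil k q p V := supp_mono fun _ _ => (·.trans h)

theorem homog_le_fil : homog k q p W ≤ fil k q p W := supp_mono fun _ _ => le_of_eq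

theorem eq_zero_of_mem_homog_of_mem_fil {f : SymbolRing k} (h : f ∈ homog k q p W)
    (h' : f ∈ fil k q p (W - 1)) : f = 0 := by
  rw [homog, mem_supp] at h
  rw [fil, mem_supp] at h'
  ext ⟨i, l⟩
  by_contra hne
  have h1 := h i l hne
  have h2 := h' i l hne
  omega

theorem mul_mem_fil {f g : SymbolRing k} (hf : f ∈ fil k q p W) (hg : g ∈ fil k q p V) :
    f * g ∈ fil k q p (W + V) :=
  map₂_mem_of_supp (LinearMap.mul k (SymbolRing k)) _ (fun i l i' l' h h' => by
    rw [LinearMap.mul_apply', mon_mul]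
    refine mon_mem_supp ?_
    push_cast
    linarith) hf hg

theorem mul_mem_homog {f g : SymbolRing k} (hf : f ∈ homog k q p W) (hg : g ∈ homog k q p V) :
    f * g ∈ homog k q p (W + V) :=
  map₂_mem_of_supp (LinearMap.mul k (SymbolRing k)) _ (fun i l i' l' h h' => by
    rw [LinearMap.mul_apply', mon_mul]
    refine mon_mem_supp ?_
    push_cast
    linarith) hf hg

theorem pow_mem_fil {f : SymbolRing k} (hf : f ∈ fil k q p W) (m : ℕ) :
    f ^ m ∈ fil k q p (m * W) := by
  induction m with
  | zero =>
    rw [pow_zero, ← mon_zero]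
    exact mon_mem_supp (by simp)
  | succ m ih =>
    rw [pow_succ]
    exact mem_fil_of_eq (mul_mem_fil ih hf) (by push_cast; ring)

theorem dh_mem_fil {f : SymbolRing k} (hf : f ∈ fil k q p W) : dh f ∈ fil k q p (W - q) :=
  map_mem_of_supp dh.toLinearMap _ (fun i l h => by
    change dh (mon i l) ∈ _
    rw [dh_mon]
    rcases i with _ | i
    · simp
    · refine Submodule.smul_mem _ _ (mon_mem_supp ?_)
      push_cast at h ⊢
      linarith) hf

theorem dh_mem_homog {f : SymbolRing k} (hf : f ∈ homog k q p W) : dh f ∈ homog k q p (W - q) :=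
  map_mem_of_supp dh.toLinearMap _ (fun i l h => by
    change dh (mon i l) ∈ _
    rw [dh_mon]
    rcases i with _ | i
    · simp
    · refine Submodule.smul_mem _ _ (mon_mem_supp ?_)
      push_cast at h ⊢
      linarith) hf

theorem ex_mem_fil {f : SymbolRing k} (hf : f ∈ fil k q p W) : ex f ∈ fil k q p W :=
  map_mem_of_supp ex.toLinearMap _ (fun i l h => by
    change ex (mon i l) ∈ _
    rw [ex_mon]
    exact Submodule.smul_mem _ _ (mon_mem_supp h)) hf

theorem ex_mem_homog {f : SymbolRing k} (hf : f ∈ homog k q p W) : ex f ∈ homog k q p W :=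
  map_mem_of_supp ex.toLinearMap _ (fun i l h => by
    change ex (mon i l) ∈ _
    rw [ex_mon]
    exact Submodule.smul_mem _ _ (mon_mem_supp h)) hf

theorem bracket_mem_fil {f g : SymbolRing k} (hf : f ∈ fil k q p W) (hg : g ∈ fil k q p V) :
    bracket f g ∈ fil k q p (W + V - q) := by
  rw [bracket_apply]
  refine sub_mem ?_ ?_
  · exact mem_fil_of_eq (mul_mem_fil (dh_mem_fil hf) (ex_mem_fil hg)) (by ring)
  · exact mem_fil_of_eq (mul_mem_fil (ex_mem_fil hf) (dh_mem_fil hg)) (by ring)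

theorem bracket_mem_homog {f g : SymbolRing k} (hf : f ∈ homog k q p W)
    (hg : g ∈ homog k q p V) : bracket f g ∈ homog k q p (W + V - q) := by
  rw [bracket_apply]
  refine sub_mem ?_ ?_
  · exact mem_homog_of_eq (mul_mem_homog (dh_mem_homog hf) (ex_mem_homog hg)) (by ring)
  · exact mem_homog_of_eq (mul_mem_homog (ex_mem_homog hf) (dh_mem_homog hg)) (by ring)

/-- The part of weight `W`. -/
noncomputable def topPart (q p W : ℤ) : SymbolRing k →ₗ[k] SymbolRing k :=
  linOfMon fun i l => if q * i + p * l = W then mon i l else 0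

theorem coeff_topPart (f : SymbolRing k) (i : ℕ) (l : ℤ) :
    (topPart q p W f).coeff (i, l) = if q * i + p * l = W then f.coeff (i, l) else 0 := by
  induction f using AddMonoidAlgebra.induction_linear with
  | zero => simp
  | add f g hf hg =>
    rw [map_add, AddMonoidAlgebra.coeff_add, Finsupp.add_apply, hf, hg]
    split_ifs <;> simp
  | single m r =>
    have e : (AddMonoidAlgebra.single m r : SymbolRing k) = r • mon m.1 m.2 := by simp [mon]
    rw [e, map_smul, AddMonoidAlgebra.coeff_smul_apply, AddMonoidAlgebra.coeff_smul_apply,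
      coeff_mon, topPart, linOfMon_mon]
    by_cases h : m.1 = i ∧ m.2 = l
    · obtain ⟨rfl, rfl⟩ := h
      by_cases h' : q * m.1 + p * m.2 = W
      · rw [if_pos h', if_pos h', coeff_mon]
      · simp [h']
    · by_cases h' : q * m.1 + p * m.2 = W
      · simp [h', coeff_mon, h]
      · simp [h', h]

theorem sub_topPart_mem_fil {f : SymbolRing k} (hf : f ∈ fil k q p W) :
    f - topPart q p W f ∈ fil k q p (W - 1) := by
  rw [fil, mem_supp] at hf ⊢
  intro i l h
  rw [AddMonoidAlgebra.coeff_sub, Finsupp.sub_apply, coeff_topPart] at h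
  split_ifs at h with h'
  · simp at h
  · rw [sub_zero] at h
    have := hf i l h
    omega

/-- Taylor expansion of `g(h - c)` to first order; each derivative in `h` lowers the weight by `q`.
-/
theorem shift_sub_mem_fil (hq : 0 ≤ q) (c : k) {g : SymbolRing k} (hg : g ∈ fil k q p V) :
    shift c g - g + c • dh g ∈ fil k q p (V - 2 * q) := by
  refine map_mem_of_supp ((shift c).toLinearMap - LinearMap.id + c • dh.toLinearMap) _
    (fun i l h => ?_) hg
  change shift c (mon i l) - mon i l + c • dh (mon i l) ∈ _
  have key : ∀ i : ℕ, (mon 1 0 - algebraMap k _ c) ^ i - mon i 0 + c • dh (mon i 0) ∈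
      fil k q p (q * i - 2 * q) := by
    intro i
    induction i with
    | zero => simp [mon_zero]
    | succ i ih =>
      have h1 : (mon 1 0 - algebraMap k _ c : SymbolRing k) ∈ fil k q p q := by
        refine sub_mem (mon_mem_supp (by simp)) ?_
        rw [Algebra.algebraMap_eq_smul_one]
        exact Submodule.smul_mem _ _ (by rw [← mon_zero]; exact mon_mem_supp (by simpa using hq))
      have h2 : (mon 1 0 - algebraMap k _ c) ^ (i + 1) - mon (i + 1) 0 +
          c • dh (mon (i + 1) 0) = (mon 1 0 - algebraMap k _ c) *
            ((mon 1 0 - algebraMap k _ c) ^ i - mon i 0 + c • dh (mon i 0)) +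
              (c ^ 2) • dh (mon i 0 : SymbolRing k) := by
        have h3 : (mon (i + 1) 0 : SymbolRing k) = mon 1 0 * mon i 0 := by
          rw [mon_mul, add_comm, zero_add]
        have h4 : dh (mon 1 0 : SymbolRing k) = 1 := by
          rw [dh_mon]; simp [mon_zero]
        rw [h3, Derivation.leibniz, h4, smul_eq_mul, smul_eq_mul]
        simp only [Algebra.smul_def, map_pow]
        ring
      rw [h2]
      refine add_mem ?_ (Submodule.smul_mem _ _ ?_)
      · exact mem_fil_of_eq (mul_mem_fil h1 ih) (by push_cast; ring)
      · have := dh_mem_fil (q := q) (p := p) (W := q * i) (f := (mon i 0 : SymbolRing k))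
          (mon_mem_supp (by simp))
        exact mem_fil_of_eq this (by push_cast; ring)
  have h5 : shift c (mon i l) - mon i l + c • dh (mon i l) =
      ((mon 1 0 - algebraMap k _ c) ^ i - mon i 0 + c • dh (mon i 0)) * mon 0 l := by
    have h6 : (mon i l : SymbolRing k) = mon i 0 * mon 0 l := by simp [mon_mul]
    have h7 : dh (mon i l : SymbolRing k) = dh (mon i 0) * mon 0 l := by
      rw [dh_mon, dh_mon, smul_mul_assoc, mon_mul]; simp
    rw [shift_mon, h7, h6]
    simp only [Algebra.smul_def]
    ring
  rw [h5]
  have h8 : (mon 0 l : SymbolRing k) ∈ fil k q p (p * l) := mon_mem_supp (by simp)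
  exact fil_mono (by linarith) (mul_mem_fil (key i) h8)

/-- Since `x ^ l g(h) = g(h - l) x ^ l`, the first-order correction carries the factor `l`, which is
what `ex` produces. -/
theorem star_sub_mem_fil (hq : 0 ≤ q) {f g : SymbolRing k} (hf : f ∈ fil k q p W)
    (hg : g ∈ fil k q p V) : star f g - f * g + ex f * dh g ∈ fil k q p (W + V - 2 * q) := by
  refine map_mem_of_supp (star.flip g - LinearMap.mulRight k g +
    LinearMap.mulRight k (dh g) ∘ₗ ex.toLinearMap) _ (fun i l h => ?_) hf
  change star (mon i l) g - mon i l * g + ex (mon i l) * dh g ∈ _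
  have e : star (mon i l) g - mon i l * g + ex (mon i l) * dh g =
      mon i l * (shift (l : k) g - g + (l : k) • dh g) := by
    rw [star_mon, ex_mon]
    simp only [Algebra.smul_def]
    ring
  rw [e]
  have h8 : (mon i l : SymbolRing k) ∈ fil k q p W := mon_mem_supp h
  exact fil_mono (by linarith) (mul_mem_fil h8 (shift_sub_mem_fil hq (l : k) hg))

/-- The commutator for the star product. -/
noncomputable def adStar (f : SymbolRing k) : SymbolRing k →ₗ[k] SymbolRing k :=
  star f - star.flip f

theorem adStar_apply (f g : SymbolRing k) : adStar f g = star f g - star g f := rfl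

theorem adStar_sub_bracket_mem_fil (hq : 0 ≤ q) {f g : SymbolRing k} (hf : f ∈ fil k q p W)
    (hg : g ∈ fil k q p V) : adStar f g - bracket f g ∈ fil k q p (W + V - 2 * q) := by
  have h1 := star_sub_mem_fil hq hf hg
  have h2 := star_sub_mem_fil hq hg hf
  rw [add_comm V W] at h2
  convert sub_mem h1 h2 using 1
  rw [adStar_apply, bracket_apply]
  ring

theorem adStar_leading (hq : 0 < q) {f f₀ g g₀ : SymbolRing k} (hf₀ : f₀ ∈ homog k q p W)
    (hf : f - f₀ ∈ fil k q p (W - 1)) (hg₀ : g₀ ∈ homog k q p V)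
    (hg : g - g₀ ∈ fil k q p (V - 1)) :
    adStar f g - bracket f₀ g₀ ∈ fil k q p (W + V - q - 1) := by
  have hfW : f ∈ fil k q p W := by
    have := add_mem (fil_mono (by linarith) hf) (homog_le_fil hf₀)
    rwa [sub_add_cancel] at this
  have hgV : g ∈ fil k q p V := by
    have := add_mem (fil_mono (by linarith) hg) (homog_le_fil hg₀)
    rwa [sub_add_cancel] at this
  have h1 := fil_mono (V := W + V - q - 1) (by omega) (adStar_sub_bracket_mem_fil hq.le hfW hgV)
  have h2 := fil_mono (V := W + V - q - 1) (by omega) (bracket_mem_fil hf hgV)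
  have h3 := fil_mono (V := W + V - q - 1) (by omega) (bracket_mem_fil (homog_le_fil hf₀) hg)
  convert add_mem h1 (add_mem h2 h3) using 1
  simp only [bracket_apply, map_sub]
  ring

theorem pow_adStar_leading (hq : 0 < q) {f f₀ g g₀ : SymbolRing k} (hf₀ : f₀ ∈ homog k q p W)
    (hf : f - f₀ ∈ fil k q p (W - 1)) (hg₀ : g₀ ∈ homog k q p V)
    (hg : g - g₀ ∈ fil k q p (V - 1)) (m : ℕ) :
    ((bracket f₀ : SymbolRing k →ₗ[k] SymbolRing k) ^ m) g₀ ∈ homog k q p (V + m * (W - q)) ∧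
      (adStar f ^ m) g - ((bracket f₀ : SymbolRing k →ₗ[k] SymbolRing k) ^ m) g₀ ∈
        fil k q p (V + m * (W - q) - 1) := by
  induction m with
  | zero => simpa using ⟨hg₀, hg⟩
  | succ m ih =>
    rw [pow_succ_apply_end', pow_succ_apply_end']
    constructor
    · exact mem_homog_of_eq (bracket_mem_homog hf₀ ih.1) (by push_cast; ring)
    · exact mem_fil_of_eq (adStar_leading hq hf₀ hf ih.1 ih.2) (by push_cast; ring)

/-- When a power of the commutator kills `g`, the same power of the bracket at `g₀` is both
homogeneous and of strictly smaller weight, hence zero. -/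
theorem isNilAt_bracket_of_adStar (hq : 0 < q) {f f₀ g g₀ : SymbolRing k}
    (hf₀ : f₀ ∈ homog k q p W) (hf : f - f₀ ∈ fil k q p (W - 1)) (hg₀ : g₀ ∈ homog k q p V)
    (hg : g - g₀ ∈ fil k q p (V - 1)) (h : IsNilAt (adStar f) g) :
    IsNilAt (bracket f₀ : SymbolRing k →ₗ[k] SymbolRing k) g₀ := by
  obtain ⟨m, hm⟩ := h
  obtain ⟨h1, h2⟩ := pow_adStar_leading hq hf₀ hf hg₀ hg m
  refine ⟨m, eq_zero_of_mem_homog_of_mem_fil h1 ?_⟩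
  rw [hm, zero_sub] at h2
  simpa using neg_mem h2

end Filtration

end SymbolRing

/-! ### Locally ad-nilpotent elements -/

section AdNilpotent

/-- The inner derivation `[z, ·]`. -/
def innerDer (k : Type*) [Field k] {A : Type*} [Ring A] [Algebra k A] (z : A) : A →ₗ[k] A :=
  LinearMap.mulLeft k z - LinearMap.mulRight k z

variable {k : Type*} [Field k] {A B : Type*} [Ring A] [Algebra k A] [Ring B] [Algebra k B]

theorem innerDer_apply (z b : A) : innerDer k z b = z * b - b * z := rfl

theorem innerDer_leibniz (z a b : A) :
    innerDer k z (a * b) = innerDer k z a * b + a * innerDer k z b := by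
  simp only [innerDer_apply]
  noncomm_ring

/-- `[z, ·]` is locally nilpotent. -/
def IsAdNilpotent (k : Type*) [Field k] {A : Type*} [Ring A] [Algebra k A] (z : A) : Prop :=
  ∀ b : A, IsNilAt (innerDer k z) b

theorem IsAdNilpotent.map {z : A} (hz : IsAdNilpotent k z) (e : A ≃ₐ[k] B) :
    IsAdNilpotent k (e z) := by
  intro b
  obtain ⟨m, hm⟩ := hz (e.symm b)
  refine ⟨m, ?_⟩
  have key : ∀ m : ℕ, (innerDer k (e z) ^ m) b = e ((innerDer k z ^ m) (e.symm b)) := by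
    intro m
    induction m with
    | zero => simp
    | succ m ih =>
      rw [pow_succ_apply_end', pow_succ_apply_end', ih, innerDer_apply, innerDer_apply]
      simp
  rw [key, hm, map_zero]

end AdNilpotent

/-! ### Leading forms of ad-nilpotent elements -/

namespace ClassicalGWA

open SymbolRing

section Leading

variable {k : Type*} [Field k] {a : k[X]}

theorem sym_innerDer_pow (z b : ClassicalGWA a) (m : ℕ) :
    sym a ((innerDer k z ^ m) b) = (adStar (sym a z) ^ m) (sym a b) := by
  induction m with
  | zero => simp
  | succ m ih =>
    rw [pow_succ_apply_end', pow_succ_apply_end', ← ih, innerDer_apply, map_sub, sym_mul, sym_mul,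
      adStar_apply]

theorem IsAdNilpotent.adStar {z : ClassicalGWA a} (hz : IsAdNilpotent k z) (b : ClassicalGWA a) :
    IsNilAt (adStar (sym a z)) (sym a b) := by
  obtain ⟨m, hm⟩ := hz b
  exact ⟨m, by rw [← sym_innerDer_pow, hm, map_zero]⟩

theorem sym_genH : sym a (genH a) = mon 1 0 := by
  rw [← mul_one (genH a), sym_genH_mul, sym_one, mul_one]

theorem sym_genX : sym a (genX a) = mon 0 1 := by
  rw [← mul_one (genX a), sym_genX_mul, sym_one, map_one, mul_one]

theorem sym_genY : sym a (genY a) = aeval (mon 1 0) a * mon 0 (-1) := by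
  rw [← mul_one (genY a), sym_genY_mul, sym_one, map_one, mul_one]

/-- For all weights with `q > 0`, the three monomials are the leading forms of `h`, `x` and, up to
the leading coefficient of `a`, `y`. -/
theorem isNilAt_leading (ha : a ≠ 0) {z : ClassicalGWA a} (hz : IsAdNilpotent k z) {q p W : ℤ}
    (hq : 0 < q) {f₀ : SymbolRing k} (hf₀ : f₀ ∈ homog k q p W)
    (hf : sym a z - f₀ ∈ fil k q p (W - 1)) :
    IsNilAt (bracket f₀ : SymbolRing k →ₗ[k] SymbolRing k) (mon 1 0) ∧
    IsNilAt (bracket f₀ : SymbolRing k →ₗ[k] SymbolRing k) (mon 0 1) ∧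
    IsNilAt (bracket f₀ : SymbolRing k →ₗ[k] SymbolRing k) (mon a.natDegree (-1)) := by
  refine ⟨?_, ?_, ?_⟩
  · refine isNilAt_bracket_of_adStar (V := q) hq hf₀ hf (mon_mem_supp (by simp)) ?_
      (IsAdNilpotent.adStar hz (genH a))
    simp [sym_genH]
  · refine isNilAt_bracket_of_adStar (V := p) hq hf₀ hf (mon_mem_supp (by simp)) ?_
      (IsAdNilpotent.adStar hz (genX a))
    simp [sym_genX]
  · have h1 : IsNilAt (bracket f₀ : SymbolRing k →ₗ[k] SymbolRing k)
        (a.leadingCoeff • mon a.natDegree (-1)) := by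
      refine isNilAt_bracket_of_adStar (V := q * a.natDegree - p) hq hf₀ hf
        (Submodule.smul_mem _ _ (mon_mem_supp (by ring))) ?_ (IsAdNilpotent.adStar hz (genY a))
      rw [sym_genY, aeval_eq_sum_range, Finset.sum_range_succ, add_mul, leadingCoeff,
        smul_mul_assoc, ← mon_eq, add_sub_cancel_right, Finset.sum_mul]
      refine sum_mem fun i hi => ?_
      rw [smul_mul_assoc, ← mon_eq]
      refine Submodule.smul_mem _ _ (mon_mem_supp ?_)
      have : (i : ℤ) + 1 ≤ a.natDegree := by exact_mod_cast Finset.mem_range.1 hi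
      nlinarith
    obtain ⟨m, hm⟩ := h1
    refine ⟨m, ?_⟩
    rw [map_smul, smul_eq_zero] at hm
    exact hm.resolve_left (leadingCoeff_ne_zero.2 ha)

end Leading

end ClassicalGWA

/-! ### Monomial Hamiltonians at a vertex -/

namespace SymbolRing

section Vertex

variable {k : Type*} [Field k]

theorem exists_bound (f : SymbolRing k) : ∃ N : ℕ, ∀ i l, f.coeff (i, l) ≠ 0 → i < N := by
  refine ⟨f.coeff.support.sup (fun m => m.1) + 1, fun i l h => Nat.lt_succ_of_le ?_⟩
  exact Finset.le_sup (f := fun m : ℕ × ℤ => m.1) (Finsupp.mem_support_iff.2 h)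

variable [CharZero k]

/-- As `h` is a factor of the Hamiltonian `f`, it lies in the kernel; but `{f, h} = -j f`, so `j =
0`. Then `{f, x}` is a nonzero multiple of `h ^ (i - 1) x`, of the same nilpotency degree as `x`,
although the derivation lowers that degree by one. -/
theorem not_isNilAt_of_monomial {c : k} (hc : c ≠ 0) {i j : ℕ} (hi : 0 < i)
    (hh : IsNilAt (bracket (c • mon i j : SymbolRing k) : SymbolRing k →ₗ[k] SymbolRing k) (mon 1 0))
    (hx : IsNilAt (bracket (c • mon i j : SymbolRing k) : SymbolRing k →ₗ[k] SymbolRing k) (mon 0 1)) :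
    False := by
  set f : SymbolRing k := c • mon i j with hf
  set D : SymbolRing k →ₗ[k] SymbolRing k := (bracket f : SymbolRing k →ₗ[k] SymbolRing k)
    with hDdef
  have hD : ∀ a b, D (a * b) = D a * b + a * D b := bracket_leibniz f
  obtain ⟨i, rfl⟩ := Nat.exists_eq_add_of_le' hi
  have hmon : ∀ s t : ℕ, IsNilAt D (mon s t) := fun s t => by
    rw [← mem_nilSubalgebra (hD := hD)] at *
    have : (mon s t : SymbolRing k) = mon 1 0 ^ s * mon 0 1 ^ t := by simp [mon_pow, mon_mul]
    rw [this]
    exact mul_mem (pow_mem hh _) (pow_mem hx _)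
  have hf1 : mon 1 0 * (c • mon i j) = f := by
    rw [mul_smul_comm, mon_mul, hf, add_comm 1 i, zero_add]
  have hfne : f ≠ 0 := smul_ne_zero hc (mon_ne_zero _ _)
  have hDh : D (mon 1 0) = 0 := by
    refine (apply_eq_zero_of_apply_mul_eq_zero hD hh (b := c • mon i j) ?_ ?_ ?_).1
    · exact (nilSubalgebra D hD).smul_mem (hmon i j) c
    · rw [hf1]; exact hfne
    · rw [hf1]; exact bracket_self f
  have hDh' : D (mon 1 0) = -((j : k) • f) := by
    change bracket f (mon 1 0) = _
    rw [bracket_apply, hf, Derivation.map_smul, Derivation.map_smul, ex_mon, ex_mon, dh_mon, dh_mon]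
    simp [mon_zero, smul_comm c]
  have hj : (j : k) = 0 := by
    rw [hDh', neg_eq_zero, smul_eq_zero] at hDh
    exact hDh.resolve_right hfne
  obtain rfl : j = 0 := by exact_mod_cast hj
  have hDx : D (mon 0 1) = (c * (i + 1 : ℕ)) • (mon 1 0 ^ i * mon 0 1) := by
    change bracket f (mon 0 1) = _
    rw [bracket_x, hf, Derivation.map_smul, dh_mon, mon_pow, smul_smul, smul_mul_assoc]
    simp
  have hci : c * ((i + 1 : ℕ) : k) ≠ 0 := mul_ne_zero hc (by exact_mod_cast i.succ_ne_zero)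
  have hDx0 : D (mon 0 1) ≠ 0 := by
    rw [hDx]
    exact smul_ne_zero hci (mul_ne_zero (pow_ne_zero _ (mon_ne_zero _ _)) (mon_ne_zero _ _))
  obtain ⟨d, hd⟩ := hx.exists_hasNilDeg (mon_ne_zero _ _)
  obtain ⟨d, rfl⟩ : ∃ e, d = e + 1 := Nat.exists_eq_succ_of_ne_zero fun h0 => by
    subst h0
    exact hDx0 (hasNilDeg_zero_iff.1 hd).2
  have h0 : HasNilDeg D (mon 1 0) 0 := hasNilDeg_zero_iff.2 ⟨mon_ne_zero _ _, hDh⟩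
  have h1 := (((h0.pow hD i).mul hD hd).smul hci)
  rw [← hDx] at h1
  have := h1.unique hd.apply
  omega

end Vertex

end SymbolRing

/-! ### The Newton polygon of an ad-nilpotent element -/

namespace ClassicalGWA

open SymbolRing

section NewtonPolygon

variable {k : Type*} [Field k] {a : k[X]}

/-- A top-weight monomial has the highest power of `h` in its slice, and for `l < 0` that power is
at least `-l deg a` by `genSym_dvd_slice`. -/
theorem topPart_sym_cone (ha : a ≠ 0) {z : ClassicalGWA a} {q p W : ℤ} (hq : 0 < q)
    (hf : sym a z ∈ fil k q p W) {i : ℕ} {l : ℤ} (h : (topPart q p W (sym a z)).coeff (i, l) ≠ 0) :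
    0 ≤ i + a.natDegree * l := by
  rw [coeff_topPart] at h
  split_ifs at h with hw
  swap
  · exact absurd rfl h
  rcases l with m | m
  · rw [Int.ofNat_eq_natCast]; positivity
  · rw [← coeff_slice] at h
    have hr0 : slice (Int.negSucc m) (sym a z) ≠ 0 := fun h0 => h (by rw [h0, coeff_zero])
    have h1 : (slice (Int.negSucc m) (sym a z)).natDegree ≤ i := by
      rw [natDegree_le_iff_coeff_eq_zero]
      intro i' hi'
      rw [coeff_slice]
      by_contra hne
      have h2 := (mem_supp.1 hf) i' _ hne
      have : (i : ℤ) + 1 ≤ i' := by exact_mod_cast hi'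
      nlinarith
    have h3 := natDegree_le_of_dvd (genSym_dvd_slice z (Int.negSucc m)) hr0
    rw [(genSym_ne_zero_and_natDegree ha m).2] at h3
    have h4 : ((a.natDegree * (m + 1) : ℕ) : ℤ) ≤ i := by exact_mod_cast h3.trans h1
    rw [Int.negSucc_eq]
    push_cast at h4
    linarith

variable [CharZero k]

/-- The top coefficient of a locally ad-nilpotent element is constant. -/
theorem coeff_top_eq_zero (ha : a ≠ 0) {z : ClassicalGWA a} (hz : IsAdNilpotent k z) {j : ℕ}
    (hj : sym a z ∈ supp fun _ l => l ≤ j) {i : ℕ} (hi : 0 < i) :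
    (sym a z).coeff (i, (j : ℤ)) = 0 := by
  by_contra hne
  set f := sym a z with hf
  set d := (slice (j : ℤ) f).natDegree with hd
  have hdi : i ≤ d := le_natDegree_of_ne_zero (by rwa [coeff_slice])
  have hsl : slice (j : ℤ) f ≠ 0 := fun h0 => hne (by rw [← coeff_slice, h0, coeff_zero])
  set c := f.coeff (d, (j : ℤ)) with hc
  have hc0 : c ≠ 0 := by
    rw [hc, ← coeff_slice, hd]
    exact leadingCoeff_ne_zero.2 hsl
  -- As `N` exceeds all exponents of `h`, the weights 1 for `h` and `N` for `x` single out the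
  -- monomial `c h ^ d x ^ j`.
  obtain ⟨N, hN⟩ := exists_bound f
  have hW : f - c • mon d j ∈ fil k 1 N (d + N * j - 1) := by
    rw [fil, mem_supp]
    intro i' l' h
    by_cases hl : l' = j
    · subst hl
      rw [AddMonoidAlgebra.coeff_sub, Finsupp.sub_apply, AddMonoidAlgebra.coeff_smul_apply,
        coeff_mon] at h
      by_cases hi' : d = i'
      · subst hi'
        simp [hc] at h
      · rw [if_neg (by tauto), smul_zero, sub_zero, ← coeff_slice] at h
        have : i' ≤ d := le_natDegree_of_ne_zero h
        have h2 : (i' : ℤ) + 1 ≤ d := by exact_mod_cast lt_of_le_of_ne this (Ne.symm hi')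
        linarith
    · rw [AddMonoidAlgebra.coeff_sub, Finsupp.sub_apply, AddMonoidAlgebra.coeff_smul_apply,
        coeff_mon, if_neg (fun h' => hl h'.2.symm), smul_zero, sub_zero] at h
      have h1 : (i' : ℤ) + 1 ≤ N := by exact_mod_cast hN i' l' h
      have h2 := mem_supp.1 hj i' l' h
      have h3 : l' + 1 ≤ j := by omega
      nlinarith
  have hmem : c • (mon d j : SymbolRing k) ∈ homog k 1 N (d + N * j) :=
    Submodule.smul_mem _ _ (mon_mem_supp (by ring))
  obtain ⟨h1, h2, -⟩ := isNilAt_leading ha hz one_pos hmem hW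
  exact not_isNilAt_of_monomial hc0 (lt_of_lt_of_le hi hdi) h1 h2

/-- The leading form of a locally ad-nilpotent element along the edge of its Newton polygon
starting at the vertex `x ^ j`. -/
theorem exists_edge [IsAlgClosed k] (ha : 0 < a.natDegree) {z : ClassicalGWA a}
    (hz : IsAdNilpotent k z) {j : ℕ} (hj0 : 0 < j)
    (hj : sym a z ∈ supp fun _ l => -j ≤ l ∧ l ≤ j) (hjj : (sym a z).coeff (0, (j : ℤ)) ≠ 0)
    (hne : ∃ i l, 0 < i ∧ (sym a z).coeff (i, l) ≠ 0) :
    ∃ (q N : ℕ) (c r : k), 0 < q ∧ 0 < N ∧ c ≠ 0 ∧ r ≠ 0 ∧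
      a.natDegree * q * N = a.natDegree * j + N ∧
      sym a z - mon 0 j * aeval (mon 1 (-q)) (C c * (X - C r) ^ N) ∈ fil k q 1 (j - 1) := by
  have ha0 : a ≠ 0 := fun h => by simp [h] at ha
  set f := sym a z with hf
  have hlt : ∀ i l, 0 < i → f.coeff (i, l) ≠ 0 → l < j := by
    intro i l hi h
    refine lt_of_le_of_ne (mem_supp.1 hj i l h).2 ?_
    rintro rfl
    exact h (coeff_top_eq_zero ha0 hz (supp_mono (fun _ _ h => h.2) hj) hi)
  -- The maximal ratio `i / (j - l)` is the slope of the edge of the Newton polygon at `x ^ j`.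
  obtain ⟨⟨p₀, l₀⟩, hm₀, hmax⟩ := (f.coeff.support.filter fun m => 0 < m.1).exists_max_image
    (fun m => (m.1 : ℚ) / ((j : ℚ) - m.2)) (by
      obtain ⟨i, l, hi, h⟩ := hne
      exact ⟨(i, l), Finset.mem_filter.2 ⟨Finsupp.mem_support_iff.2 h, hi⟩⟩)
  obtain ⟨hm₀', hp₀⟩ := Finset.mem_filter.1 hm₀
  rw [Finsupp.mem_support_iff] at hm₀'
  dsimp only at hp₀
  have hl₀ := hlt p₀ l₀ hp₀ hm₀'
  obtain ⟨q₀, hq₀⟩ : ∃ q₀ : ℕ, (j : ℤ) - l₀ = q₀ := ⟨((j : ℤ) - l₀).toNat, by omega⟩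
  have hq₀pos : 0 < q₀ := by omega
  -- Coprimality makes every lattice point of the edge of the form `(t p, j - t q)`.
  obtain ⟨g, p, q, hg, hcop, hp₀g, hq₀g⟩ := Nat.exists_coprime' (m := p₀) (n := q₀)
    (Nat.gcd_pos_of_pos_left _ hp₀)
  have hp : 0 < p := Nat.pos_of_ne_zero fun h => by simp [h] at hp₀g; omega
  have hq : 0 < q := Nat.pos_of_ne_zero fun h => by simp [h] at hq₀g; omega
  have hfil : f ∈ fil k q p (p * j) := by
    rw [fil, mem_supp]
    intro i l h
    rcases Nat.eq_zero_or_pos i with rfl | hi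
    · have := (mem_supp.1 hj 0 l h).2
      have hp' : (0 : ℤ) ≤ p := by positivity
      simp only [Nat.cast_zero, mul_zero, zero_add]
      exact mul_le_mul_of_nonneg_left this hp'
    · have h1 := hmax (i, l) (Finset.mem_filter.2 ⟨Finsupp.mem_support_iff.2 h, hi⟩)
      dsimp only at h1
      have h2 := hlt i l hi h
      have h3 : (0 : ℚ) < (j : ℚ) - l := by
        have : ((l : ℤ) : ℚ) < (j : ℤ) := by exact_mod_cast h2
        simpa using this
      have h4 : (0 : ℚ) < (j : ℚ) - l₀ := by
        have : ((l₀ : ℤ) : ℚ) < (j : ℤ) := by exact_mod_cast hl₀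
        simpa using this
      rw [div_le_div_iff₀ h3 h4] at h1
      have h5 : (i : ℤ) * (j - l₀) ≤ p₀ * (j - l) := by exact_mod_cast h1
      rw [hq₀, hp₀g, hq₀g] at h5
      push_cast at h5
      have hg' : (0 : ℤ) < g := by exact_mod_cast hg
      have h6 : (g : ℤ) * (i * q) ≤ g * (p * (j - l)) := by linarith
      have := le_of_mul_le_mul_left h6 hg'
      linarith
  obtain ⟨T, hT⟩ := exists_bound f
  -- The range is long enough: `T` bounds the exponents of `h`, and `t ≤ t p`.
  set P : k[X] := ∑ t ∈ Finset.range T, monomial t (f.coeff (t * p, (j : ℤ) - t * q)) with hP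
  have hPc : ∀ t, P.coeff t = f.coeff (t * p, (j : ℤ) - t * q) := by
    intro t
    rw [hP, finsetSum_coeff]
    simp only [coeff_monomial]
    rw [Finset.sum_ite_eq' (Finset.range T) t]
    split_ifs with h
    · rfl
    · by_contra hne'
      have h1 := hT _ _ (Ne.symm hne')
      have h2 : t * 1 ≤ t * p := Nat.mul_le_mul_left t hp
      exact h (Finset.mem_range.2 (by omega))
  have hhom : mon 0 j * aeval (mon p (-q)) P ∈ homog k q p (p * j) := by
    rw [aeval_eq_sum_range, Finset.mul_sum]
    refine sum_mem fun t _ => ?_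
    rw [mul_smul_comm, mon_pow, mon_mul]
    refine Submodule.smul_mem _ _ (mon_mem_supp ?_)
    push_cast
    ring
  have htop : mon 0 j * aeval (mon p (-q)) P = topPart q p (p * j) f := by
    ext ⟨i, l⟩
    rw [coeff_topPart]
    split_ifs with hw
    · have h1 : (q : ℤ) * i = p * (j - l) := by linarith
      have h2 : (p : ℤ) ∣ i := (Nat.isCoprime_iff_coprime.2 hcop).dvd_of_dvd_mul_left ⟨_, h1⟩
      obtain ⟨t, rfl⟩ : p ∣ i := by exact_mod_cast h2
      have hp' : (p : ℤ) ≠ 0 := by exact_mod_cast hp.ne'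
      have h3 : (q : ℤ) * t = j - l := by
        apply mul_left_cancel₀ hp'
        push_cast at h1
        linarith
      have hl : l = j - t * q := by linarith
      subst hl
      have e : ((p * t, (j : ℤ) - t * q) : ℕ × ℤ) = (0 + t * p, (j : ℤ) + (t : ℤ) * (-(q : ℤ))) := by
        rw [Prod.mk.injEq]
        exact ⟨by ring, by ring⟩
      conv_lhs => rw [e, coeff_mon_mul, coeff_aeval_mon hp.ne', hPc, mul_comm t p]
    · by_contra hne'
      exact hw (mem_supp.1 hhom i l hne')
  have hP0 : P.coeff 0 ≠ 0 := by rw [hPc]; simpa using hjj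
  have hPg : P.coeff g ≠ 0 := by
    rw [hPc]
    have e1 : g * p = p₀ := by rw [hp₀g, mul_comm]
    have e2 : (j : ℤ) - g * q = l₀ := by
      rw [hq₀g] at hq₀
      push_cast at hq₀
      linarith
    rw [e1, e2]
    exact hm₀'
  have hPdeg : P.natDegree ≠ 0 := by
    have := le_natDegree_of_ne_zero hPg
    omega
  have hPN : f.coeff (P.natDegree * p, (j : ℤ) - P.natDegree * q) ≠ 0 := by
    rw [← hPc]
    exact leadingCoeff_ne_zero.2 fun h => hP0 (by simp [h])
  have hsub := sub_topPart_mem_fil hfil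
  rw [← htop] at hsub
  obtain ⟨n1, n2, n3⟩ := isNilAt_leading ha0 hz (by exact_mod_cast hq) hhom hsub
  have hcone : a.natDegree * q * P.natDegree ≤ a.natDegree * j + p * P.natDegree := by
    have h1 : (topPart q p (p * j) f).coeff (P.natDegree * p, (j : ℤ) - P.natDegree * q) ≠ 0 := by
      rw [coeff_topPart, if_pos]
      · exact hPN
      · push_cast; ring
    have h2 := topPart_sym_cone ha0 (by exact_mod_cast hq) hfil h1
    push_cast at h2
    zify
    linarith
  have hj2 : q * P.natDegree ≤ 2 * j := by
    have := (mem_supp.1 hj _ _ hPN).1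
    zify
    linarith
  obtain ⟨rfl, hN, c, r, hc, hr, hPcr⟩ :=
    edge_of_isNilAt ha hj0 hp hP0 hPdeg rfl n1 n2 n3 hcone hj2
  refine ⟨q, P.natDegree, c, r, hq, Nat.pos_of_ne_zero hPdeg, hc, hr, hN, ?_⟩
  rw [← hPcr]
  simpa using hsub

end NewtonPolygon

end ClassicalGWA

/-! ### Triangular substitutions on symbols -/

namespace SymbolRing

section Triangular

variable {k : Type*} [Field k]

/-- The operator by which `h + c x ^ q` acts on symbols. -/
noncomputable def opTri (c : k) (q : ℕ) : Module.End k (SymbolRing k) :=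
  star (mon 1 0 + c • mon 0 q)

theorem opTri_apply (c : k) (q : ℕ) (g : SymbolRing k) :
    opTri c q g = mon 1 0 * g + c • (mon 0 q * shift (q : k) g) := by
  rw [opTri, map_add, map_smul, LinearMap.add_apply, LinearMap.smul_apply, star_mon, star_mon]
  simp [shift_zero]

theorem opTri_mul_mon (c : k) (q : ℕ) (g : SymbolRing k) (l : ℤ) :
    opTri c q (g * mon 0 l) = opTri c q g * mon 0 l := by
  rw [opTri_apply, opTri_apply, map_mul, shift_mon_zero]
  simp only [Algebra.smul_def]
  ring

theorem pow_opTri_mul_mon (c : k) (q : ℕ) (i : ℕ) (g : SymbolRing k) (l : ℤ) :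
    (opTri c q ^ i) (g * mon 0 l) = (opTri c q ^ i) g * mon 0 l := by
  induction i with
  | zero => simp
  | succ i ih => rw [pow_succ_apply_end', pow_succ_apply_end', ih, opTri_mul_mon]

/-- The effect on symbols of the automorphism `h ↦ h + c x ^ q`, `x ↦ x`. -/
noncomputable def tri (c : k) (q : ℕ) : Module.End k (SymbolRing k) :=
  linOfMon fun i l => (opTri c q ^ i) (mon 0 l)

theorem tri_mon (c : k) (q i : ℕ) (l : ℤ) : tri c q (mon i l) = (opTri c q ^ i) (mon 0 l) :=
  linOfMon_mon _ i l

theorem tri_aeval_mul (c : k) (q : ℕ) (r : k[X]) (l : ℤ) :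
    tri c q (aeval (mon 1 0) r * mon 0 l) = aeval (opTri c q) r (mon 0 l) := by
  induction r using Polynomial.induction_on' with
  | add P Q hP hQ => simp only [map_add, add_mul, LinearMap.add_apply, hP, hQ]
  | monomial s d =>
    rw [aeval_monomial, aeval_monomial, ← Algebra.smul_def, ← Algebra.smul_def, smul_mul_assoc,
      ← mon_eq, map_smul, LinearMap.smul_apply, tri_mon]

theorem tri_mulOp_h (c : k) (q : ℕ) :
    tri c q * ClassicalGWA.mulOp (mon 1 0) = opTri c q * tri c q := by
  refine lin_ext fun i l => ?_
  rw [Module.End.mul_apply, Module.End.mul_apply, ClassicalGWA.mulOp_apply, mon_mul, tri_mon,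
    tri_mon, ← pow_succ_apply_end', add_comm 1 i, zero_add]

theorem opX_mul_opTri (c : k) (q : ℕ) :
    ClassicalGWA.opX * opTri c q = (opTri c q - 1) * ClassicalGWA.opX := by
  refine LinearMap.ext fun g => ?_
  rw [Module.End.mul_apply, Module.End.mul_apply, LinearMap.sub_apply, Module.End.one_apply,
    ClassicalGWA.opX_apply, ClassicalGWA.opX_apply, opTri_apply, opTri_apply]
  simp only [map_add, map_smul, map_mul, shift_h, shift_mon_zero, shift_shift, map_one]
  rw [add_comm (1 : k) q]
  simp only [Algebra.smul_def]
  ring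

theorem tri_mul_opX (c : k) (q : ℕ) :
    tri c q * ClassicalGWA.opX = ClassicalGWA.opX * tri c q := by
  refine lin_ext fun i l => ?_
  have e : ClassicalGWA.opX (mon i l : SymbolRing k) =
      aeval (mon 1 0) ((X - 1 : k[X]) ^ i) * mon 0 (1 + l) := by
    rw [ClassicalGWA.opX_apply, shift_mon, mul_left_comm, mon_mul]
    simp only [map_pow, map_sub, aeval_X, map_one, add_zero]
  have h : SemiconjBy ClassicalGWA.opX (opTri c q) (opTri c q - 1) := opX_mul_opTri c q
  have h2 := LinearMap.congr_fun (h.pow_right i).eq (mon 0 l)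
  rw [Module.End.mul_apply, Module.End.mul_apply] at h2
  rw [Module.End.mul_apply, Module.End.mul_apply, e, tri_aeval_mul, tri_mon, h2,
    ClassicalGWA.opX_apply, shift_mon_zero, mon_mul]
  simp

theorem tri_mul_opXinv (c : k) (q : ℕ) :
    tri c q * ClassicalGWA.opXinv = ClassicalGWA.opXinv * tri c q := by
  apply ClassicalGWA.eq_of_mul_opX
  rw [mul_assoc, ClassicalGWA.opXinv_mul_opX, mul_assoc, tri_mul_opX, ← mul_assoc,
    ClassicalGWA.opXinv_mul_opX, mul_one, one_mul]

/-- Only nonnegative powers of `x` occur in `h + c x ^ q`, so the lower end of the range of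
`x`-degrees survives the reduction. -/
theorem tri_mem_supp (c : k) (q : ℕ) {v : ℤ} {f : SymbolRing k}
    (hf : f ∈ supp fun _ l => v ≤ l) : tri c q f ∈ supp fun _ l => v ≤ l := by
  refine map_mem_of_supp _ _ (fun i l hl => ?_) hf
  rw [tri_mon]
  induction i with
  | zero => simpa using mon_mem_supp (k := k) (P := fun _ l => v ≤ l) (i := 0) hl
  | succ i ih =>
    rw [pow_succ_apply_end', opTri]
    have h0 : (mon 1 0 + c • mon 0 q : SymbolRing k) ∈ supp fun _ l => 0 ≤ l :=
      add_mem (mon_mem_supp le_rfl) (Submodule.smul_mem _ _ (mon_mem_supp (by positivity)))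
    refine map₂_mem_of_supp star _ (fun i l i' l' h h' => ?_) h0 ih
    rw [star_mon, shift_mon, ← mul_assoc, mul_right_comm, mon_mul]
    have : (mon 1 0 - algebraMap k _ (l : k) : SymbolRing k) ^ i' =
        aeval (mon 1 0) ((X - C (l : k)) ^ i') := by simp
    rw [this, aeval_eq_sum_range, Finset.mul_sum]
    refine sum_mem fun t _ => ?_
    rw [mul_smul_comm, mon_pow, mon_mul]
    exact Submodule.smul_mem _ _ (mon_mem_supp (by simp; linarith))

variable {q : ℕ} {W : ℤ}

/-- For these weights `h + c x ^ q` is homogeneous, and the shifts in the star product only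
contribute lower weight. -/
theorem tri_sub_subst_mem_fil (hq : 0 < q) (c : k) {f : SymbolRing k} (hf : f ∈ fil k q 1 W) :
    tri c q f - subst (mon 1 0 + c • mon 0 q) f ∈ fil k q 1 (W - 1) := by
  set u : SymbolRing k := mon 1 0 + c • mon 0 q with hu
  refine map_mem_of_supp (tri c q - (subst u).toLinearMap) _ (fun i l h => ?_) hf
  rw [LinearMap.sub_apply, AlgHom.toLinearMap_apply, subst_mon, tri_mon,
    ← one_mul (mon 0 l), pow_opTri_mul_mon, one_mul, ← sub_mul]
  have hq' : (0 : ℤ) < q := by exact_mod_cast hq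
  have hu1 : u ∈ fil k q 1 q :=
    add_mem (mon_mem_supp (by simp)) (Submodule.smul_mem _ _ (mon_mem_supp (by simp)))
  have key : ∀ i : ℕ, (opTri c q ^ i) 1 - u ^ i ∈ fil k q 1 (q * i - 1) := by
    intro i
    induction i with
    | zero => simp
    | succ i ih =>
      have hi : (opTri c q ^ i) 1 ∈ fil k q 1 (q * i) := by
        have := add_mem (fil_mono (sub_le_self _ zero_le_one) ih)
          (mem_fil_of_eq (pow_mem_fil hu1 i) (mul_comm _ _))
        rwa [sub_add_cancel] at this
      rw [pow_succ_apply_end', opTri_apply]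
      set g := (opTri c q ^ i) 1
      have e : mon 1 0 * g + c • (mon 0 q * shift (q : k) g) - u ^ (i + 1) =
          u * (g - u ^ i) + c • (mon 0 q * ((shift (q : k) g - g + (q : k) • dh g) -
            (q : k) • dh g)) := by
        rw [hu]
        simp only [Algebra.smul_def]
        ring
      rw [e]
      have h1 := fil_mono (V := q * i - q) (by linarith) (shift_sub_mem_fil hq'.le (q : k) hi)
      have h2 : shift (q : k) g - g + (q : k) • dh g - (q : k) • dh g ∈ fil k q 1 (q * i - q) :=
        sub_mem h1 (Submodule.smul_mem _ _ (dh_mem_fil hi))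
      have h3 : (mon 0 q : SymbolRing k) ∈ fil k q 1 q := mon_mem_supp (by simp)
      refine add_mem (mem_fil_of_eq (mul_mem_fil hu1 ih) (by push_cast; ring))
        (Submodule.smul_mem _ _ (fil_mono ?_ (mul_mem_fil h3 h2)))
      push_cast
      linarith
  have h8 : (mon 0 l : SymbolRing k) ∈ fil k q 1 l := mon_mem_supp (by simp)
  exact fil_mono (by linarith) (mul_mem_fil (key i) h8)

end Triangular

end SymbolRing

/-! ### Triangular automorphisms -/

namespace ClassicalGWA

open SymbolRing

section Triangular

variable {k : Type*} [Field k] {a : k[X]}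

section Abstract

variable {S : Type*} [Ring S] [Algebra k S] {H U : S}

theorem mul_add_smul_pow (h : U * H = (H - 1) * U) (c : k) (q : ℕ) :
    U * (H + c • U ^ q) = (H + c • U ^ q - 1) * U := by
  rw [mul_add, h, mul_smul_comm, ← pow_succ', sub_mul, sub_mul, add_mul, smul_mul_assoc,
    ← pow_succ]
  abel

theorem pow_mul_pow_of_mul_eq (h : U * H = (H - 1) * U) (q i : ℕ) :
    U ^ q * H ^ i = (H - (q : S)) ^ i * U ^ q := by
  have h1 : ∀ q : ℕ, U ^ q * H = (H - (q : S)) * U ^ q := by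
    intro q
    induction q with
    | zero => simp
    | succ q ih =>
      rw [pow_succ', mul_assoc, ih, ← mul_assoc, mul_sub, h, ← Nat.cast_comm, ← sub_mul,
        Nat.cast_succ, mul_assoc, sub_sub, add_comm (1 : S)]
  exact (show SemiconjBy _ _ _ from h1 q).pow_right i

/-- Powers of `U` can be moved to the right past `H`, so every term other than `H ^ s` ends in `U`.
The cofactor `b` is the correction to be added to `y`. -/
theorem exists_aeval_add_smul_pow (h : U * H = (H - 1) * U) (c : k) {q : ℕ} (hq : 0 < q)
    (r : k[X]) : ∃ b : S, aeval (H + c • U ^ q) r = aeval H r + b * U := by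
  obtain ⟨q, rfl⟩ := Nat.exists_eq_add_of_le' hq
  induction r using Polynomial.induction_on' with
  | add P Q hP hQ =>
    obtain ⟨b, hb⟩ := hP
    obtain ⟨b', hb'⟩ := hQ
    exact ⟨b + b', by rw [map_add, hb, hb', map_add, add_mul]; abel⟩
  | monomial s d =>
    have : ∀ s : ℕ, ∃ b : S, (H + c • U ^ (q + 1)) ^ s = H ^ s + b * U := by
      intro s
      induction s with
      | zero => exact ⟨0, by simp⟩
      | succ s ih =>
        obtain ⟨b, hb⟩ := ih
        refine ⟨(H + c • U ^ (q + 1)) * b + c • ((H - ((q + 1 : ℕ) : S)) ^ s * U ^ q), ?_⟩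
        rw [pow_succ', hb, mul_add, add_mul H, smul_mul_assoc, pow_mul_pow_of_mul_eq h,
          ← pow_succ']
        simp only [add_mul, smul_mul_assoc, mul_assoc, ← pow_succ]
        abel
    obtain ⟨b, hb⟩ := this s
    refine ⟨d • b, ?_⟩
    rw [aeval_monomial, aeval_monomial, hb, ← Algebra.smul_def, ← Algebra.smul_def, smul_add,
      smul_mul_assoc]

theorem add_smul_add_neg_smul (c : k) (u v : S) : u + c • v + -c • v = u := by
  rw [neg_smul, add_neg_cancel_right]

theorem add_neg_smul_add_smul (c : k) (u v : S) : u + -c • v + c • v = u := by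
  rw [neg_smul, neg_add_cancel_right]

end Abstract

/-- The image of `y` is `y + b`, where `a(h + c x ^ q) = a(h) + b x`; this makes `y x = a` hold, and
the other relations in `y` follow after right multiplication by `x`. -/
theorem exists_triHom (ha : a ≠ 0) (c : k) {q : ℕ} (hq : 0 < q) :
    ∃ F : ClassicalGWA a →ₐ[k] ClassicalGWA a,
      F (genH a) = genH a + c • genX a ^ q ∧ F (genX a) = genX a := by
  obtain ⟨b, hb⟩ := exists_aeval_add_smul_pow (genX_mul_genH a) c hq a
  set H := genH a + c • genX a ^ q with hH
  have h₁ : genX a * H = (H - 1) * genX a := mul_add_smul_pow (genX_mul_genH a) c q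
  have h₄ : (genY a + b) * genX a = aeval H a := by rw [add_mul, genY_mul_genX, hb]
  refine ⟨lift H (genX a) (genY a + b) h₁ ?_ ?_ h₄, lift_genH .., lift_genX ..⟩
  · apply mul_genX_injective ha
    have h₁' : H * genX a = genX a * (H + 1) := by
      rw [mul_add, h₁, sub_mul, one_mul, mul_one, sub_add_cancel]
    rw [mul_assoc, h₁', ← mul_assoc, h₄, mul_assoc, h₄, mul_add, add_mul,
      ← mul_aeval_of_comm (U := H) rfl]
    simp
  · apply mul_genX_injective ha
    rw [mul_assoc, h₄, mul_aeval_of_comm h₁]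

/-- The automorphism `h ↦ h + c x ^ q`, `x ↦ x`. -/
theorem exists_triEquiv (ha : a ≠ 0) (c : k) {q : ℕ} (hq : 0 < q) :
    ∃ F : ClassicalGWA a ≃ₐ[k] ClassicalGWA a,
      F (genH a) = genH a + c • genX a ^ q ∧ F (genX a) = genX a := by
  have hcomp : ∀ (F G : ClassicalGWA a →ₐ[k] ClassicalGWA a), F (genX a) = genX a →
      G (genX a) = genX a → F (G (genH a)) = genH a → F.comp G = AlgHom.id k _ := by
    intro F G hF hG h
    refine algHom_ext h (by simp [hF, hG]) (mul_genX_injective ha ?_)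
    have e : F (G (genX a)) = genX a := by rw [hG, hF]
    nth_rw 1 [← e]
    rw [← AlgHom.comp_apply, ← map_mul, genY_mul_genX, ← aeval_algHom_apply, AlgHom.comp_apply, h,
      AlgHom.id_apply, genY_mul_genX]
  obtain ⟨F, hF, hF'⟩ := exists_triHom ha c hq
  obtain ⟨G, hG, hG'⟩ := exists_triHom ha (-c) hq
  refine ⟨AlgEquiv.ofAlgHom F G (hcomp F G hF' hG' ?_) (hcomp G F hG' hF' ?_), hF, hF'⟩
  · rw [hG, map_add, map_smul, map_pow, hF, hF']
    exact add_smul_add_neg_smul c _ _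
  · rw [hF, map_add, map_smul, map_pow, hG, hG']
    exact add_neg_smul_add_smul c _ _

theorem rep_triH (c : k) (q : ℕ) : rep a (genH a + c • genX a ^ q) = opTri c q := by
  refine LinearMap.ext fun g => ?_
  have h : sym a (genX a ^ q) = mon 0 q := by
    rw [← gen_natCast, sym_gen, genSym_natCast, map_one, one_mul]
  rw [rep_apply, map_add, map_smul, h, opTri, ← mul_one (genH a), sym_genH_mul, sym_one, mul_one]

/-- The value at `y` need not be given: it is forced by `F(y) x = a(F(h))`, because `opX` is
invertible. -/
theorem sym_triEquiv (F : ClassicalGWA a →ₐ[k] ClassicalGWA a) (c : k) (q : ℕ)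
    (hH : F (genH a) = genH a + c • genX a ^ q) (hX : F (genX a) = genX a) (b : ClassicalGWA a) :
    sym a (F b) = tri c q (sym a b) := by
  have hY : rep a (F (genY a)) = aeval (opTri c q) a * opXinv := by
    apply eq_of_mul_opX
    rw [mul_assoc, opXinv_mul_opX, mul_one, ← rep_genX, ← hX, ← map_mul, ← map_mul, genY_mul_genX,
      ← aeval_algHom_apply, hH, ← aeval_algHom_apply, rep_triH]
  suffices h : LinearMap.eqLocus (sym a ∘ₗ F.toLinearMap) (tri c q ∘ₗ sym a) = ⊤ by
    have hb : b ∈ LinearMap.eqLocus (sym a ∘ₗ F.toLinearMap) (tri c q ∘ₗ sym a) :=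
      h ▸ Submodule.mem_top
    exact hb
  have hmem : ∀ b, b ∈ LinearMap.eqLocus (sym a ∘ₗ F.toLinearMap) (tri c q ∘ₗ sym a) ↔
      sym a (F b) = tri c q (sym a b) := fun b => Iff.rfl
  refine submodule_eq_top _ ?_ ?_ ?_ ?_
  · rw [hmem, map_one, sym_one, ← mon_zero, tri_mon, pow_zero, Module.End.one_apply]
  · intro b hb
    rw [hmem] at hb ⊢
    rw [map_mul, sym_mul', hb, hH, rep_triH, sym_mul', rep_genH]
    exact (LinearMap.congr_fun (tri_mulOp_h c q) _).symm
  · intro b hb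
    rw [hmem] at hb ⊢
    rw [map_mul, sym_mul', hb, hX, sym_mul', rep_genX]
    exact (LinearMap.congr_fun (tri_mul_opX c q) _).symm
  · intro b hb
    rw [hmem] at hb ⊢
    rw [map_mul, sym_mul', hb, hY, sym_mul', rep_genY]
    have e : tri c q * mulOp (aeval (mon 1 0) a) = aeval (opTri c q) a * tri c q := by
      rw [← aeval_mulOp]
      exact mul_aeval_of_comm (tri_mulOp_h c q) a
    have e2 : tri c q * (mulOp (aeval (mon 1 0) a) * opXinv) =
        aeval (opTri c q) a * opXinv * tri c q := by
      rw [← mul_assoc, e, mul_assoc, tri_mul_opXinv, mul_assoc]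
    exact (LinearMap.congr_fun e2 _).symm

/-- If the leading form of `z` is `c x ^ j (h x ^ (-q) - r) ^ N`, a triangular automorphism lowers
the degree in `x`. -/
theorem sym_triEquiv_mem_supp (F : ClassicalGWA a →ₐ[k] ClassicalGWA a) {r : k} {q : ℕ}
    (hq : 0 < q) (hH : F (genH a) = genH a + r • genX a ^ q) (hX : F (genX a) = genX a)
    {z : ClassicalGWA a} {v j : ℤ} {N : ℕ} (hN : 0 < N) {c : k}
    (hv : sym a z ∈ supp fun _ l => v ≤ l)
    (hz : sym a z - mon 0 j * aeval (mon 1 (-q)) (C c * (X - C r) ^ N) ∈ fil k q 1 (j - 1)) :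
    sym a (F z) ∈ supp fun _ l => v ≤ l ∧ l ≤ j - 1 := by
  have hq' : (0 : ℤ) < q := by exact_mod_cast hq
  have hN' : (0 : ℤ) < N := by exact_mod_cast hN
  have hFz := sym_triEquiv F r q hH hX z
  have hmain : sym a (F z) ∈ supp fun _ l => l ≤ j - 1 := by
    rw [hFz]
    set f := sym a z
    set f₀ : SymbolRing k := mon 0 j * aeval (mon 1 (-q)) (C c * (X - C r) ^ N) with hf₀
    -- The substitution sends `h x ^ (-q)` to `h x ^ (-q) + r`, so the edge form collapses to one
    -- monomial, whose `x`-degree is below `j`.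
    have hsub : subst (mon 1 0 + r • mon 0 q) f₀ = c • mon N (j - N * q) := by
      have e : subst (mon 1 0 + r • mon 0 q : SymbolRing k) (mon 1 (-(q : ℤ))) =
          mon 1 (-(q : ℤ)) + algebraMap k _ r := by
        rw [subst_mon, pow_one, add_mul, mon_mul, smul_mul_assoc, mon_mul]
        simp [mon_zero, Algebra.algebraMap_eq_smul_one]
      rw [hf₀, map_mul, ← aeval_algHom_apply, e, subst_mon]
      simp only [map_mul, map_pow, map_sub, aeval_X, aeval_C, add_sub_cancel_right, pow_zero,
        one_mul]
      rw [← Algebra.smul_def, mul_smul_comm, mon_pow, mon_mul]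
      congr 2
      · ring
      · ring
    -- As `h` has positive weight and `x` has weight one, a bound on the weight bounds the degree in
    -- `x`.
    have hlow : ∀ g ∈ fil k q 1 (j - 1), g ∈ (supp fun _ l => l ≤ j - 1 : Submodule k _) := by
      intro g hg
      refine supp_mono (fun i l h => ?_) hg
      have : (0 : ℤ) ≤ q * i := by positivity
      linarith
    have hf₀mem : f₀ ∈ fil k q 1 j := by
      rw [hf₀, aeval_eq_sum_range, Finset.mul_sum]
      refine sum_mem fun t _ => ?_
      rw [mul_smul_comm, mon_pow, mon_mul]
      exact Submodule.smul_mem _ _ (mon_mem_supp (by push_cast; linarith))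
    have hfmem : f ∈ fil k q 1 j := by
      have := add_mem (fil_mono (by linarith) hz) hf₀mem
      rwa [sub_add_cancel] at this
    have h1 := tri_sub_subst_mem_fil hq r hfmem
    have h2 : subst (mon 1 0 + r • mon 0 q) (f - f₀) ∈ fil k q 1 (j - 1) := by
      refine map_mem_of_supp (subst (mon 1 0 + r • mon 0 q : SymbolRing k)).toLinearMap _
        (fun i l h => ?_) hz
      rw [AlgHom.toLinearMap_apply, subst_mon]
      have hu : (mon 1 0 + r • mon 0 q : SymbolRing k) ∈ fil k q 1 q :=
        add_mem (mon_mem_supp (by simp)) (Submodule.smul_mem _ _ (mon_mem_supp (by simp)))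
      have h8 : (mon 0 l : SymbolRing k) ∈ fil k q 1 l := mon_mem_supp (by simp)
      exact fil_mono (by linarith) (mul_mem_fil (pow_mem_fil hu i) h8)
    have e : tri r q f = (tri r q f - subst (mon 1 0 + r • mon 0 q) f) +
        subst (mon 1 0 + r • mon 0 q) (f - f₀) + c • mon N (j - N * q) := by
      rw [← hsub, map_sub]
      ring
    rw [e]
    refine add_mem (hlow _ (add_mem h1 h2)) (Submodule.smul_mem _ _ (mon_mem_supp ?_))
    nlinarith
  have hmin := tri_mem_supp r q hv
  rw [← hFz] at hmin
  rw [mem_supp] at hmin hmain ⊢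
  exact fun i l h => ⟨hmin i l h, hmain i l h⟩

end Triangular

end ClassicalGWA

/-! ### The swap and the affine isomorphisms -/

namespace ClassicalGWA

open SymbolRing

section Isomorphisms

variable {k : Type*} [Field k] {a b : k[X]}

/-- The homomorphism `h ↦ 1 - h`, `x ↦ y`, `y ↦ x`. -/
noncomputable def swapHom (h : b = a.comp (-X)) : ClassicalGWA a →ₐ[k] ClassicalGWA b :=
  lift (1 - genH b) (genY b) (genX b)
    (by rw [mul_sub, genY_mul_genH]; simp only [sub_mul, add_mul, mul_one, one_mul]; abel)
    (by rw [mul_sub, genX_mul_genH]; simp only [sub_mul, add_mul, mul_one, one_mul]; abel)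
    (by
      rw [genY_mul_genX, h, aeval_comp]
      congr 2
      simp)
    (by
      rw [genX_mul_genY, h, aeval_comp]
      congr 2
      simp)

theorem swapHom_genH (h : b = a.comp (-X)) : swapHom h (genH a) = 1 - genH b := lift_genH ..

theorem swapHom_genX (h : b = a.comp (-X)) : swapHom h (genX a) = genY b := lift_genX ..

theorem swapHom_genY (h : b = a.comp (-X)) : swapHom h (genY a) = genX b := lift_genY ..

theorem swapHom_comp (h : b = a.comp (-X)) (h' : a = b.comp (-X)) :
    (swapHom h').comp (swapHom h) = AlgHom.id k _ := by
  refine algHom_ext ?_ ?_ ?_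
  · simp [swapHom_genH]
  · simp [swapHom_genX, swapHom_genY]
  · simp [swapHom_genX, swapHom_genY]

theorem eq_comp_neg_X (h : b = a.comp (-X)) : a = b.comp (-X) := by
  rw [h, comp_assoc]; simp

/-- The isomorphism `k[h](σ_cl, a(h)) ≃ k[h](σ_cl, a(-h))` exchanging `x` and `y`. -/
noncomputable def swapEquiv (h : b = a.comp (-X)) : ClassicalGWA a ≃ₐ[k] ClassicalGWA b :=
  AlgEquiv.ofAlgHom (swapHom h) (swapHom (eq_comp_neg_X h)) (swapHom_comp _ _) (swapHom_comp _ _)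

theorem swapEquiv_gen (h : b = a.comp (-X)) (l : ℤ) : swapEquiv h (gen a l) = gen b (-l) := by
  change swapHom h _ = _
  obtain ⟨m, rfl | rfl⟩ := l.eq_nat_or_neg
  · rw [gen_natCast, gen_neg_natCast, map_pow, swapHom_genX]
  · rw [neg_neg, gen_natCast, gen_neg_natCast, map_pow, swapHom_genY]

/-- The swap is not simply visible on symbols, but on normal forms it sends `r(h) gen a l` to `r(1 -
h) gen b (-l)`. -/
theorem sym_swapEquiv_mem_supp (ha : a ≠ 0) (h : b = a.comp (-X)) {z : ClassicalGWA a} {v u : ℤ}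
    (hz : sym a z ∈ supp fun _ l => v ≤ l ∧ l ≤ u) :
    sym b (swapEquiv h z) ∈ supp fun _ l => -u ≤ l ∧ l ≤ -v := by
  obtain ⟨f, rfl⟩ := exists_normalForm z
  rw [Finsupp.sum, map_sum, map_sum]
  refine sum_mem fun l hl => ?_
  have hl' : slice l (sym a (f.sum fun l r => aeval (genH a) r * gen a l)) ≠ 0 := by
    rw [slice_sym_sum]
    exact mul_ne_zero (Finsupp.mem_support_iff.1 hl) (genSym_ne_zero ha l)
  obtain ⟨i, hi⟩ : ∃ i, (slice l (sym a (f.sum fun l r => aeval (genH a) r * gen a l))).coeff i ≠ 0 := by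
    by_contra! h0
    exact hl' (Polynomial.ext h0)
  rw [coeff_slice] at hi
  have hvu := mem_supp.1 hz i l hi
  have e : aeval (swapEquiv h (genH a)) (f l) = aeval (genH b) ((f l).comp (1 - X)) := by
    rw [show swapEquiv h (genH a) = 1 - genH b from swapHom_genH h, aeval_comp]
    simp
  rw [map_mul, swapEquiv_gen, ← aeval_algHom_apply, e, sym_aeval_mul, sym_gen, ← mul_assoc, ← map_mul]
  exact aeval_mul_mon_mem_supp _ fun _ => by omega

/-- The homomorphism `h ↦ h - γ`, `x ↦ x`, `y ↦ c y`. -/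
noncomputable def affineHom (c γ : k) (h : a = C c * b.comp (X + C γ)) :
    ClassicalGWA a →ₐ[k] ClassicalGWA b :=
  lift (genH b - algebraMap k _ γ) (genX b) (c • genY b)
    (by
      rw [mul_sub, genX_mul_genH, ← Algebra.commutes]
      simp only [sub_mul, one_mul]
      abel)
    (by
      rw [smul_mul_assoc, mul_sub, genY_mul_genH, ← Algebra.commutes, mul_smul_comm]
      congr 1
      simp only [sub_mul, one_mul, add_mul]
      abel)
    (by
      rw [mul_smul_comm, genX_mul_genY, h, map_mul, aeval_C, aeval_comp, Algebra.smul_def]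
      congr 3
      simp
      abel)
    (by
      rw [smul_mul_assoc, genY_mul_genX, h, map_mul, aeval_C, aeval_comp, Algebra.smul_def]
      congr 3
      simp)

theorem affineHom_comp {c γ d δ : k} (h : a = C c * b.comp (X + C γ))
    (h' : b = C d * a.comp (X + C δ)) (hcd : c * d = 1) (hγ : γ + δ = 0) :
    (affineHom d δ h').comp (affineHom c γ h) = AlgHom.id k _ := by
  obtain rfl : δ = -γ := by rw [eq_neg_iff_add_eq_zero, add_comm, hγ]
  refine algHom_ext ?_ ?_ ?_
  · simp [affineHom, lift_genH]
  · simp [affineHom, lift_genX]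
  · simp [affineHom, lift_genY, smul_smul, hcd]

theorem nonempty_equiv_of_eq_comp {c γ : k} (hc : c ≠ 0) (h : a = C c * b.comp (X + C γ)) :
    Nonempty (ClassicalGWA a ≃ₐ[k] ClassicalGWA b) := by
  have h' : b = C c⁻¹ * a.comp (X + C (-γ)) := by
    rw [h, mul_comp, comp_assoc, C_comp, ← mul_assoc, ← C_mul, inv_mul_cancel₀ hc]
    simp
  exact ⟨AlgEquiv.ofAlgHom (affineHom c γ h) (affineHom c⁻¹ (-γ) h')
    (affineHom_comp _ _ (inv_mul_cancel₀ hc) (neg_add_cancel γ))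
    (affineHom_comp _ _ (mul_inv_cancel₀ hc) (add_neg_cancel γ))⟩

end Isomorphisms

/-! ### Reduction of ad-nilpotent elements to polynomials in `x` -/

section Reduction

variable {k : Type*} [Field k] {a : k[X]}

/-- An element whose symbol has constant coefficients is a polynomial in `x`. -/
theorem mem_range_aeval_genX (ha : 0 < a.natDegree) {z : ClassicalGWA a}
    (hz : ∀ i l, 0 < i → (sym a z).coeff (i, l) = 0) : ∃ p : k[X], z = aeval (genX a) p := by
  have ha0 : a ≠ 0 := fun h => by simp [h] at ha
  obtain ⟨T, hT⟩ : ∃ T : ℕ, ∀ m : ℕ, (sym a z).coeff (0, (m : ℤ)) ≠ 0 → m < T := by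
    refine ⟨(sym a z).coeff.support.sup (fun m => m.2.toNat) + 1, fun m h => Nat.lt_succ_of_le ?_⟩
    exact Finset.le_sup (f := fun m : ℕ × ℤ => m.2.toNat) (Finsupp.mem_support_iff.2 h)
  refine ⟨∑ t ∈ Finset.range T, monomial t ((sym a z).coeff (0, (t : ℤ))), sym_injective ha0 ?_⟩
  rw [map_sum, map_sum]
  have e : ∀ (t : ℕ) (c : k), sym a (aeval (genX a) (monomial t c)) = c • mon 0 t := by
    intro t c
    rw [aeval_monomial, ← Algebra.smul_def, map_smul, ← gen_natCast, sym_gen, genSym_natCast,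
      map_one, one_mul]
  simp only [e]
  ext ⟨i, l⟩
  have e2 : (∑ t ∈ Finset.range T, (sym a z).coeff (0, (t : ℤ)) • (mon 0 t : SymbolRing k)).coeff (i, l) =
      ∑ t ∈ Finset.range T, if 0 = i ∧ (t : ℤ) = l then (sym a z).coeff (0, (t : ℤ)) else 0 := by
    rw [AddMonoidAlgebra.coeff_sum, Finsupp.finsetSum_apply]
    refine Finset.sum_congr rfl fun t _ => ?_
    rw [AddMonoidAlgebra.coeff_smul_apply, coeff_mon]
    simp
  rw [e2]
  rcases Nat.eq_zero_or_pos i with rfl | hi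
  · rcases l with m | m
    · rw [Int.ofNat_eq_natCast]
      simp only [true_and, Nat.cast_inj]
      rw [Finset.sum_ite_eq' (Finset.range T) m]
      split_ifs with h
      · rfl
      · by_contra hne
        exact h (Finset.mem_range.2 (hT m hne))
    -- A constant coefficient of a negative power of `x` would be divisible by a polynomial of
    -- positive degree, so it is zero.
    · rw [Finset.sum_eq_zero fun t _ => if_neg (by omega)]
      by_contra hne
      have hs : slice (Int.negSucc m) (sym a z) ≠ 0 := fun h0 => hne (by
        rw [← coeff_slice, h0, coeff_zero])
      have h1 := natDegree_le_of_dvd (genSym_dvd_slice z (Int.negSucc m)) hs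
      rw [(genSym_ne_zero_and_natDegree ha0 m).2] at h1
      have h2 : (slice (Int.negSucc m) (sym a z)).natDegree ≤ 0 := by
        rw [natDegree_le_iff_coeff_eq_zero]
        intro i hi
        rw [coeff_slice, hz i _ hi]
      have : 0 < a.natDegree * (m + 1) := by positivity
      omega
  · rw [hz i l hi, Finset.sum_eq_zero fun t _ => if_neg (by omega)]

variable [CharZero k] [IsAlgClosed k]

/-- Up to isomorphism, a locally ad-nilpotent element is a polynomial in `x`. -/
theorem exists_equiv_eq_aeval_genX (s : ℕ) : ∀ {a : k[X]}, 0 < a.natDegree →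
    ∀ {z : ClassicalGWA a}, IsAdNilpotent k z → ∀ u v : ℕ, u + v = s →
      (sym a z ∈ supp fun _ l => -(v : ℤ) ≤ l ∧ l ≤ u) →
      ∃ (b : k[X]) (ψ : ClassicalGWA a ≃ₐ[k] ClassicalGWA b) (p : k[X]),
        (b = a ∨ b = a.comp (-X)) ∧ ψ z = aeval (genX b) p := by
  induction s with
  | zero =>
    intro a ha z hz u v huv hsupp
    have ha0 : a ≠ 0 := fun h => by simp [h] at ha
    obtain ⟨rfl, rfl⟩ : u = 0 ∧ v = 0 := by omega
    obtain ⟨p, hp⟩ := mem_range_aeval_genX ha (z := z) fun i l hi => by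
      by_contra hne
      have h1 := mem_supp.1 hsupp i l hne
      obtain rfl : l = 0 := by simpa using le_antisymm h1.2 (by simpa using h1.1)
      exact hne (coeff_top_eq_zero ha0 hz (j := 0) (supp_mono (fun _ _ h => h.2) hsupp) hi)
    exact ⟨a, AlgEquiv.refl, p, Or.inl rfl, hp⟩
  | succ s ih =>
    -- The inequality `v ≤ u` places the symbol in the range `-j ≤ l ≤ j` required by `exists_edge`
    -- with `j = u`; the swap handles the other case.
    have key : ∀ {a : k[X]}, 0 < a.natDegree → ∀ {z : ClassicalGWA a}, IsAdNilpotent k z →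
        ∀ u v : ℕ, u + v = s + 1 → v ≤ u → (sym a z ∈ supp fun _ l => -(v : ℤ) ≤ l ∧ l ≤ u) →
        ∃ (b : k[X]) (ψ : ClassicalGWA a ≃ₐ[k] ClassicalGWA b) (p : k[X]),
          (b = a ∨ b = a.comp (-X)) ∧ ψ z = aeval (genX b) p := by
      intro a ha z hz u v huv hvu hsupp
      have ha0 : a ≠ 0 := fun h => by simp [h] at ha
      obtain ⟨u, rfl⟩ : ∃ u', u = u' + 1 := Nat.exists_eq_succ_of_ne_zero (by omega)
      -- The top coefficient is constant, so if its constant term vanishes the range shrinks at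
      -- once.
      by_cases hjj : (sym a z).coeff (0, ((u + 1 : ℕ) : ℤ)) = 0
      · refine ih ha hz u v (by omega) ?_
        rw [mem_supp] at hsupp ⊢
        intro i l hne
        have h1 := hsupp i l hne
        refine ⟨h1.1, ?_⟩
        by_contra hlt
        obtain rfl : l = ((u + 1 : ℕ) : ℤ) := by omega
        rcases Nat.eq_zero_or_pos i with rfl | hi
        · exact hne hjj
        · exact hne (coeff_top_eq_zero ha0 hz (mem_supp.2 fun i l h => (hsupp i l h).2) hi)
      by_cases hex : ∃ i l, 0 < i ∧ (sym a z).coeff (i, l) ≠ 0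
      · obtain ⟨q, N, c, r, hq, hN, -, -, -, hlead⟩ := exists_edge ha hz (Nat.succ_pos u)
          (supp_mono (fun _ _ h => ⟨by omega, h.2⟩) hsupp) hjj hex
        obtain ⟨F, hF, hF'⟩ := exists_triEquiv ha0 r hq
        have h1 := sym_triEquiv_mem_supp (F : ClassicalGWA a →ₐ[k] ClassicalGWA a) hq hF hF' hN
          (supp_mono (fun _ _ h => h.1) hsupp) hlead
        obtain ⟨b, ψ, p, hb, hψ⟩ := ih ha (hz.map F) u v (by omega)
          (supp_mono (fun _ _ h => ⟨h.1, by omega⟩) h1)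
        exact ⟨b, F.trans ψ, p, hb, hψ⟩
      · push Not at hex
        obtain ⟨p, hp⟩ := mem_range_aeval_genX ha hex
        exact ⟨a, AlgEquiv.refl, p, Or.inl rfl, hp⟩
    intro a ha z hz u v huv hsupp
    rcases le_total v u with h | h
    · exact key ha hz u v huv h hsupp
    · have ha0 : a ≠ 0 := fun h => by simp [h] at ha
      have h1 := sym_swapEquiv_mem_supp ha0 (b := a.comp (-X)) rfl hsupp
      rw [neg_neg] at h1
      obtain ⟨b, ψ, p, hb, hψ⟩ := key (by simpa [natDegree_comp] using ha)
        (hz.map (swapEquiv (b := a.comp (-X)) rfl)) v u (by omega) h h1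
      refine ⟨b, (swapEquiv rfl).trans ψ, p, ?_, hψ⟩
      rw [← eq_comp_neg_X rfl] at hb
      exact hb.symm

end Reduction

end ClassicalGWA

/-! ### A difference equation for polynomials -/

section PolynomialShift

variable {k : Type*} [Field k] [CharZero k]

/-- The polynomial `r + d X` is invariant under `X ↦ X - 1`, so it takes one value at `0, -1, -2, …`
and is constant in characteristic zero. -/
theorem Polynomial.exists_eq_of_comp_X_sub_one_sub_eq_C {r : k[X]} {d : k}
    (h : r.comp (X - 1) - r = C d) : ∃ e, r = C (-d) * X + C e := by
  set s := r + C d * X with hs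
  have hs1 : s.comp (X - 1) = s := by
    rw [hs, add_comp, mul_comp, C_comp, X_comp, eq_add_of_sub_eq h]
    ring
  have hev : ∀ n : ℕ, s.eval (-(n : k)) = s.eval 0 := by
    intro n
    induction n with
    | zero => simp
    | succ n ih =>
      rw [← ih]
      conv_rhs => rw [← hs1]
      rw [eval_comp]
      congr 1
      simp
      ring
  have hsc : s = C (s.eval 0) := by
    refine eq_of_infinite_eval_eq _ _ (Set.infinite_of_injective_forall_mem
      (f := fun n : ℕ => -(n : k)) (fun m n hmn => by simpa using hmn) fun n => ?_)
    simp [hev]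
  refine ⟨s.eval 0, ?_⟩
  rw [← hsc, hs, C_neg]
  ring

end PolynomialShift

/-! ### Coefficients of star products -/

namespace SymbolRing

section Slices

variable {k : Type*} [Field k]

theorem slice_mul_mon (l : ℤ) (f : SymbolRing k) :
    slice (l + 1) (f * mon 0 1) = slice l f := by
  ext i
  rw [coeff_slice, coeff_slice, mul_comm, ← coeff_mon_mul 0 i 1 l f, zero_add, add_comm]

theorem slice_mon (l l' : ℤ) (i : ℕ) :
    slice l (mon i l' : SymbolRing k) = if l' = l then X ^ i else 0 := linOfMon_mon _ _ _

theorem slice_mon_mul_shift (l : ℤ) (f : SymbolRing k) :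
    slice (l + 1) (mon 0 1 * shift 1 f) = (slice l f).comp (X - 1) := by
  have : slice (l + 1) ∘ₗ ClassicalGWA.opX =
      (aeval (X - 1 : k[X])).toLinearMap ∘ₗ slice l := by
    refine lin_ext fun i l' => ?_
    have e : ClassicalGWA.opX (mon i l' : SymbolRing k) =
        aeval (mon 1 0) ((X - 1 : k[X]) ^ i) * mon 0 (1 + l') := by
      rw [ClassicalGWA.opX_apply, shift_mon, mul_left_comm, mon_mul]
      simp only [map_pow, map_sub, aeval_X, map_one, add_zero]
    rw [LinearMap.comp_apply, LinearMap.comp_apply, e, slice_aeval_mul, slice_mon,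
      AlgHom.toLinearMap_apply]
    by_cases h : l' = l
    · simp [h, add_comm]
    · rw [if_neg h, if_neg (by omega), map_zero]
  rw [comp_eq_aeval]
  exact LinearMap.congr_fun this f

theorem star_mon_mon (i i' : ℕ) (l l' : ℤ) : (star (mon i l) (mon i' l') : SymbolRing k) =
    aeval (mon 1 0) (X ^ i * (X - C (l : k)) ^ i') * mon 0 (l + l') := by
  rw [star_mon, shift_mon, ClassicalGWA.mon_zero_add, mon_eq i l]
  simp only [map_mul, map_pow, map_sub, aeval_X, aeval_C]
  ring

theorem slice_zero_star {f g : SymbolRing k} (hf : f ∈ supp fun _ l => 0 ≤ l)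
    (hg : g ∈ supp fun _ l => 0 ≤ l) : slice 0 (star f g) = slice 0 f * slice 0 g := by
  have := map₂_mem_of_supp
    (star.compr₂ (slice (0 : ℤ)) - (LinearMap.mul k k[X]).compl₁₂ (slice 0) (slice 0)) ⊥
    (fun i l i' l' h h' => ?_) hf hg
  · rw [Submodule.mem_bot] at this
    exact sub_eq_zero.1 this
  · change slice 0 (star (mon i l) (mon i' l')) - slice 0 (mon i l) * slice 0 (mon i' l') ∈ _
    rw [star_mon_mon, slice_aeval_mul, slice_mon, slice_mon, Submodule.mem_bot]
    by_cases hl : l = 0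
    · by_cases hl' : l' = 0
      · simp [hl, hl']
      · simp [hl, hl']
    · rw [if_neg (by omega), if_neg hl, zero_mul, sub_zero]

theorem star_mem_supp {f g : SymbolRing k} (hf : f ∈ supp fun _ l => 0 ≤ l)
    (hg : g ∈ supp fun _ l => 0 ≤ l) : star f g ∈ supp fun _ l => 0 ≤ l := by
  refine map₂_mem_of_supp star _ (fun i l i' l' h h' => ?_) hf hg
  rw [star_mon_mon]
  exact aeval_mul_mon_mem_supp _ fun _ => add_nonneg h h'

end Slices

end SymbolRing

/-! ### Rigidity of isomorphisms -/

namespace ClassicalGWA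

open SymbolRing

section Rigidity

variable {k : Type*} [Field k] {a : k[X]}

/-- Here `[x, h] = -x` and `[x, y]` is a polynomial in `h`; the elements at which a derivation is
nilpotent form a subalgebra. -/
theorem isAdNilpotent_genX : IsAdNilpotent k (genX a) := by
  set D := innerDer k (genX a)
  have hD : ∀ b c, D (b * c) = D b * c + b * D c := innerDer_leibniz _
  have hX : IsNilAt D (genX a) := ⟨1, by simp [D, innerDer_apply]⟩
  have hH : IsNilAt D (genH a) := by
    refine isNilAt_of_apply ?_
    have : D (genH a) = -genX a := by
      rw [innerDer_apply, genX_mul_genH, sub_mul, one_mul]; abel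
    rw [this]
    exact neg_mem (s := nilSubalgebra D hD) hX
  have hY : IsNilAt D (genY a) := by
    refine isNilAt_of_apply ?_
    have h1 : D (genY a) = aeval (genH a) (a.comp (X - 1) - a) := by
      rw [innerDer_apply, genX_mul_genY, genY_mul_genX, map_sub, aeval_comp_sub_one]
    rw [h1]
    have h2 : (genH a) ∈ nilSubalgebra D hD := hH
    exact Algebra.adjoin_le (Set.singleton_subset_iff.2 h2) (aeval_mem_adjoin_singleton _ _)
  have htop : nilSubalgebra D hD = ⊤ := by
    rw [eq_top_iff, ← adjoin_gen, Algebra.adjoin_le_iff]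
    rintro b (rfl | rfl | rfl)
    · exact hH
    · exact hX
    · exact hY
  intro b
  have : b ∈ nilSubalgebra D hD := htop ▸ Algebra.mem_top
  exact this

theorem exists_sym_mem_supp (z : ClassicalGWA a) :
    ∃ T : ℕ, sym a z ∈ supp fun _ l => -(T : ℤ) ≤ l ∧ l ≤ T := by
  refine ⟨(sym a z).coeff.support.sup fun m => m.2.natAbs, mem_supp.2 fun i l h => ?_⟩
  have := Finset.le_sup (f := fun m : ℕ × ℤ => m.2.natAbs) (Finsupp.mem_support_iff.2 h)
  dsimp only at this
  omega

theorem coeff_sym_aeval_genX (r : k[X]) (m : ℕ) :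
    (sym a (aeval (genX a) r)).coeff (0, (m : ℤ)) = r.coeff m := by
  induction r using Polynomial.induction_on' with
  | add P Q hP hQ => simp [hP, hQ]
  | monomial s c =>
    rw [aeval_monomial, ← Algebra.smul_def, map_smul, ← gen_natCast, sym_gen, genSym_natCast,
      map_one, one_mul, AddMonoidAlgebra.coeff_smul_apply, coeff_mon, coeff_monomial]
    simp

theorem aeval_genX_injective :
    Function.Injective (aeval (genX a) : k[X] →ₐ[k] ClassicalGWA a) := by
  intro P Q h
  ext m
  rw [← coeff_sym_aeval_genX (a := a), h, coeff_sym_aeval_genX]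

theorem slice_eq_zero_of_natDegree_lt (ha : a ≠ 0) (z : ClassicalGWA a) {l : ℤ} (hl : l < 0)
    (h : (slice l (sym a z)).natDegree < a.natDegree) : slice l (sym a z) = 0 := by
  by_contra hne
  obtain ⟨m, rfl⟩ : ∃ m, l = Int.negSucc m := ⟨(-l - 1).toNat, by omega⟩
  have h1 := natDegree_le_of_dvd (genSym_dvd_slice z (Int.negSucc m)) hne
  rw [(genSym_ne_zero_and_natDegree ha m).2] at h1
  nlinarith

variable [CharZero k]

/-- Commuting with `x` makes every coefficient invariant under `h ↦ h - 1`, hence constant. -/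
theorem exists_eq_aeval_of_commute (ha : 0 < a.natDegree) {z : ClassicalGWA a}
    (h : genX a * z = z * genX a) : ∃ p : k[X], z = aeval (genX a) p := by
  refine mem_range_aeval_genX ha fun i l hi => ?_
  have h1 : slice (l + 1) (sym a (genX a * z)) = slice (l + 1) (sym a (z * genX a)) := by rw [h]
  rw [sym_genX_mul, sym_mul_genX, slice_mon_mul_shift, slice_mul_mon, ← sub_eq_zero, ← C_0] at h1
  obtain ⟨e, he⟩ := exists_eq_of_comp_X_sub_one_sub_eq_C h1
  rw [← coeff_slice, he, neg_zero, C_0, zero_mul, zero_add, coeff_C_of_ne_zero hi.ne']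

/-- An isomorphism sending `x` to a polynomial in `x` forces a divisibility of the defining
polynomials. -/
theorem exists_dvd_comp_of_genX {b : k[X]} (ha : 0 < a.natDegree) (hb : 2 ≤ b.natDegree)
    (φ : ClassicalGWA a ≃ₐ[k] ClassicalGWA b) {p : k[X]}
    (hp : φ (genX a) = aeval (genX b) p) : ∃ c, b ∣ a.comp (X + C c) := by
  have hb0 : b ≠ 0 := fun h => by simp [h] at hb
  have hpdeg : p.natDegree = 1 := by
    -- The preimage of `x` commutes with `x`, hence equals some `g(x)`. Then `g ∘ p = X`, which
    -- forces degree one.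
    obtain ⟨g, hg⟩ := exists_eq_aeval_of_commute ha (z := φ.symm (genX b)) (by
      apply φ.injective
      rw [map_mul, map_mul, φ.apply_symm_apply, hp, (show Commute (genX b) (aeval (genX b) p) from
        mul_aeval_of_comm (U := genX b) (H := genX b) rfl p).eq])
    have h1 : aeval (genX b) (g.comp p) = aeval (genX b) (X : k[X]) := by
      rw [aeval_comp, ← hp, aeval_algHom_apply, ← hg, φ.apply_symm_apply, aeval_X]
    have h2 := congrArg natDegree (aeval_genX_injective h1)
    rw [natDegree_comp, natDegree_X] at h2
    exact Nat.eq_one_of_mul_eq_one_left h2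
  obtain ⟨lam, hlam, mu, rfl⟩ := natDegree_eq_one.1 hpdeg
  set f := sym b (φ (genH a)) with hf
  have hφx : φ (genX a) = lam • genX b + mu • 1 := by
    rw [hp, map_add, map_mul, aeval_C, aeval_X, aeval_C, Algebra.smul_def, Algebra.smul_def,
      mul_one]
  have hcomm : φ (genX a) * φ (genH a) = (φ (genH a) - 1) * φ (genX a) := by
    rw [← map_mul, genX_mul_genH, map_mul, map_sub, map_one]
  -- Compare the coefficients of `x ^ (l + 1)` in the image of `x h = (h - 1) x`; the scalar `mu`
  -- contributes only for `l = -1`.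
  have hsl : ∀ l, (slice l f).comp (X - 1) - slice l f =
      C (-((if l = 0 then 1 else 0) + if l = -1 then mu / lam else 0)) := by
    intro l
    have h1 := congrArg (fun z => slice (l + 1) (sym b z)) hcomm
    have h2 : (φ (genH a) - 1) * φ (genX a) = lam • (φ (genH a) * genX b) + mu • φ (genH a) -
        (lam • genX b + mu • 1) := by
      rw [sub_mul, one_mul, hφx, mul_add, mul_smul_comm, mul_smul_comm, mul_one]
    rw [h2, hφx, add_mul, smul_mul_assoc, smul_mul_assoc, one_mul] at h1
    simp only [map_add, map_sub, map_smul, sym_genX_mul, sym_mul_genX, slice_mon_mul_shift,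
      slice_mul_mon, sym_genX, sym_one, ← mon_zero, ← hf] at h1
    rw [slice_mon, slice_mon] at h1
    have h3 : C lam * ((slice l f).comp (X - 1) - slice l f) =
        -(C lam * (if l = 0 then 1 else 0) + C mu * if l = -1 then 1 else 0) := by
      simp only [smul_eq_C_mul] at h1
      have e1 : (if 1 = l + 1 then X ^ 0 else 0 : k[X]) = if l = 0 then 1 else 0 := by
        rw [pow_zero]
        exact if_congr (by omega) rfl rfl
      have e2 : (if 0 = l + 1 then X ^ 0 else 0 : k[X]) = if l = -1 then 1 else 0 := by
        rw [pow_zero]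
        exact if_congr (by omega) rfl rfl
      rw [e1, e2] at h1
      linear_combination h1
    apply mul_left_cancel₀ (C_ne_zero.2 hlam)
    have e : C mu = C lam * C (mu / lam) := by rw [← C_mul, mul_div_cancel₀ _ hlam]
    rw [h3, e]
    split_ifs <;> simp only [C_neg, C_add, C_0, C_1] <;> ring
  -- The difference equation bounds the degree of each slice by one, while a nonzero negative slice
  -- has degree at least `deg b ≥ 2`.
  have hdeg : ∀ l < 0, slice l f = 0 := by
    intro l hl
    obtain ⟨e, he⟩ := exists_eq_of_comp_X_sub_one_sub_eq_C (hsl l)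
    refine slice_eq_zero_of_natDegree_lt hb0 _ hl (lt_of_le_of_lt ?_ (lt_of_lt_of_le one_lt_two hb))
    rw [← hf, he]
    exact natDegree_linear_le
  have hmu : mu = 0 := by
    have := hsl (-1)
    rw [hdeg (-1) (by norm_num)] at this
    simpa [hlam] using this
  obtain ⟨c, hc⟩ := exists_eq_of_comp_X_sub_one_sub_eq_C (hsl 0)
  have hc' : slice 0 f = X + C c := by simpa using hc
  have hfpos : f ∈ supp fun _ l => 0 ≤ l := by
    rw [mem_supp]
    intro i l hne
    by_contra hl
    rw [← coeff_slice, hdeg l (by omega)] at hne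
    exact hne (coeff_zero i)
  have hpow : ∀ r : k[X], sym b (aeval (φ (genH a)) r) ∈ (supp fun _ l => 0 ≤ l : Submodule k _) ∧
      slice 0 (sym b (aeval (φ (genH a)) r)) = r.comp (X + C c) := by
    intro r
    induction r using Polynomial.induction_on with
    | C d =>
      have : sym b (aeval (φ (genH a)) (C d)) = d • mon 0 0 := by
        rw [aeval_C, Algebra.algebraMap_eq_smul_one, map_smul, sym_one, mon_zero]
      rw [this]
      refine ⟨Submodule.smul_mem _ _ (mon_mem_supp le_rfl), ?_⟩
      rw [map_smul, slice_mon, smul_eq_C_mul]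
      simp
    | add P Q hP hQ =>
      rw [map_add, map_add, map_add, hP.2, hQ.2, add_comp]
      exact ⟨add_mem hP.1 hQ.1, rfl⟩
    | monomial s d h =>
      rw [pow_succ, ← mul_assoc, map_mul, aeval_X, sym_mul, slice_zero_star h.1 hfpos, h.2, ← hf,
        hc', mul_comp _ X, X_comp]
      exact ⟨star_mem_supp h.1 hfpos, rfl⟩
  refine ⟨c, ?_⟩
  -- In degree zero the left side is `lam` times the coefficient of `x⁻¹` in `φ(y)`, a multiple of
  -- `b`; the right side is `a(h + c)`.
  have hyx : φ (genY a) * φ (genX a) = aeval (φ (genH a)) a := by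
    rw [← map_mul, genY_mul_genX, ← aeval_algHom_apply]
  rw [← (hpow a).2, ← hyx, hφx, hmu, zero_smul, add_zero, mul_smul_comm, map_smul, map_smul,
    sym_mul_genX, show (0 : ℤ) = -1 + 1 from rfl, slice_mul_mon]
  exact dvd_smul_of_dvd lam (genSym_dvd_slice (φ (genY a)) (-1))

variable [IsAlgClosed k]

theorem exists_dvd_comp {b : k[X]} (ha : 0 < a.natDegree) (hb : 2 ≤ b.natDegree)
    (φ : ClassicalGWA a ≃ₐ[k] ClassicalGWA b) :
    ∃ (b' : k[X]) (c : k), (b' = b ∨ b' = b.comp (-X)) ∧ b' ∣ a.comp (X + C c) := by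
  obtain ⟨T, hT⟩ := exists_sym_mem_supp (φ (genX a))
  obtain ⟨b', ψ, p, hb', hp⟩ := exists_equiv_eq_aeval_genX _ (by omega)
    (isAdNilpotent_genX.map φ) T T rfl hT
  obtain ⟨c, hc⟩ := exists_dvd_comp_of_genX ha
    (by rcases hb' with rfl | rfl <;> simpa [natDegree_comp] using hb) (φ.trans ψ) hp
  exact ⟨b', c, hb', hc⟩

end Rigidity

end ClassicalGWA

/-! ### Matching of roots -/

section Roots

theorem exists_equiv_of_map_univ_eq {ι κ γ : Type*} [Fintype ι] [Fintype κ] {f : ι → γ}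
    {g : κ → γ} (h : Finset.univ.val.map f = Finset.univ.val.map g) :
    ∃ e : ι ≃ κ, ∀ i, g (e i) = f i := by
  classical
  have hcard : ∀ c, Fintype.card {i // f i = c} = Fintype.card {i // g i = c} := by
    intro c
    have := congrArg (Multiset.count c) h
    rw [Multiset.count_map, Multiset.count_map] at this
    rw [Fintype.card_subtype, Fintype.card_subtype, Finset.card_def, Finset.card_def,
      Finset.filter_val, Finset.filter_val]
    simpa only [eq_comm] using this
  exact ⟨Equiv.ofFiberEquiv fun c => Fintype.equivOfCardEq (hcard c),
    Equiv.ofFiberEquiv_map _⟩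

variable {k : Type*} [Field k] {ι κ : Type*} [Fintype ι] [Fintype κ]

theorem roots_C_mul_prod_X_sub_C {c : k} (hc : c ≠ 0) (α : ι → k) :
    (C c * ∏ i, (X - C (α i))).roots = Finset.univ.val.map α := by
  rw [roots_C_mul _ hc, Finset.prod_eq_multiset_prod,
    ← roots_multiset_prod_X_sub_C (Finset.univ.val.map α), Multiset.map_map]
  rfl

theorem exists_equiv_of_prod_eq {c d : k} (hc : c ≠ 0) (hd : d ≠ 0) {α : ι → k} {β : κ → k}
    (h : C c * ∏ i, (X - C (α i)) = C d * ∏ i, (X - C (β i))) :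
    ∃ e : ι ≃ κ, ∀ i, β (e i) = α i :=
  exists_equiv_of_map_univ_eq <| by
    rw [← roots_C_mul_prod_X_sub_C hc, ← roots_C_mul_prod_X_sub_C hd, h]

theorem prod_X_sub_C_comp_add (α : ι → k) (c : k) :
    (∏ i, (X - C (α i))).comp (X + C c) = ∏ i, (X - C (α i - c)) := by
  rw [prod_comp]
  refine Finset.prod_congr rfl fun i _ => ?_
  simp
  ring

theorem prod_X_sub_C_comp_neg (α : ι → k) :
    (∏ i, (X - C (α i))).comp (-X) = C ((-1) ^ Fintype.card ι) * ∏ i, (X - C (-α i)) := by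
  rw [prod_comp, ← Finset.card_univ, C_pow, ← Finset.prod_const, ← Finset.prod_mul_distrib]
  refine Finset.prod_congr rfl fun i _ => ?_
  simp
  ring

/-- Polarization turns equal squared differences into equal products of differences from `i₀`. The
sign is read off at one index with `v j ≠ v i₀` and propagates to all others. -/
theorem exists_sign_of_sq_eq {ι : Type*} {u v : ι → k} (i₀ : ι) [NeZero (2 : k)]
    (h : ∀ i j, (u i - u j) ^ 2 = (v i - v j) ^ 2) :
    ∃ ε : k, (ε = 1 ∨ ε = -1) ∧ ∀ i, u i - u i₀ = ε * (v i - v i₀) := by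
  have hmul : ∀ i j, (u i - u i₀) * (u j - u i₀) = (v i - v i₀) * (v j - v i₀) := by
    intro i j
    refine mul_left_cancel₀ (two_ne_zero (α := k)) ?_
    linear_combination h i i₀ + h j i₀ - h i j
  by_cases h0 : ∃ j, v j - v i₀ ≠ 0
  · obtain ⟨j, hj⟩ := h0
    obtain ⟨ε, hε, hεj⟩ : ∃ ε : k, (ε = 1 ∨ ε = -1) ∧ u j - u i₀ = ε * (v j - v i₀) := by
      rcases sq_eq_sq_iff_eq_or_eq_neg.1 (h j i₀) with h1 | h1
      · exact ⟨1, Or.inl rfl, by rw [h1, one_mul]⟩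
      · exact ⟨-1, Or.inr rfl, by rw [h1, neg_one_mul]⟩
    refine ⟨ε, hε, fun i => mul_right_cancel₀ hj ?_⟩
    have hε2 : ε * ε = 1 := by rcases hε with rfl | rfl <;> ring
    have h1 := hmul i j
    rw [hεj] at h1
    linear_combination ε * h1 - (u i - u i₀) * (v j - v i₀) * hε2
  · push Not at h0
    refine ⟨1, Or.inl rfl, fun i => ?_⟩
    have := h i i₀
    rw [h0 i, zero_pow two_ne_zero, pow_eq_zero_iff two_ne_zero] at this
    rw [this, h0 i, mul_zero]

end Roots

/-! ### The equivalence -/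

theorem corollary2p1p6 {k : Type*} [Field k] [IsAlgClosed k] [CharZero k]
    (a₁ a₂ : k[X]) (ha₁ : 0 < a₁.natDegree) (ha₂ : 0 < a₂.natDegree)
    (α : Fin a₁.natDegree → k) (β : Fin a₂.natDegree → k)
    (hα : a₁ = C a₁.leadingCoeff * ∏ i, (X - C (α i)))
    (hβ : a₂ = C a₂.leadingCoeff * ∏ i, (X - C (β i))) :
    List.TFAE [
      Nonempty (GWA (sigmaCl k) a₁ ≃ₐ[k] GWA (sigmaCl k) a₂),
      ∃ e : a₁.natDegree = a₂.natDegree, ∃ τ : Equiv.Perm (Fin a₁.natDegree),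
        ∀ i j, (α i - α j) ^ 2 = (β (Fin.cast e (τ i)) - β (Fin.cast e (τ j))) ^ 2,
      ∃ e : a₁.natDegree = a₂.natDegree, ∃ τ : Equiv.Perm (Fin a₁.natDegree),
        ∃ ε : k, (ε = 1 ∨ ε = -1) ∧
          ∀ i, α i - α ⟨0, ha₁⟩ =
            ε * (β (Fin.cast e (τ i)) - β (Fin.cast e (τ ⟨0, ha₁⟩)))] := by
  have hc₁ : a₁.leadingCoeff ≠ 0 := leadingCoeff_ne_zero.2 fun h => by simp [h] at ha₁
  have hc₂ : a₂.leadingCoeff ≠ 0 := leadingCoeff_ne_zero.2 fun h => by simp [h] at ha₂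
  have hprod₁ : ∀ c, a₁.comp (X + C c) = C a₁.leadingCoeff * ∏ i, (X - C (α i - c)) := fun c => by
    conv_lhs => rw [hα]
    rw [mul_comp, C_comp, prod_X_sub_C_comp_add]
  have hprod₂ : a₂.comp (-X) = C (a₂.leadingCoeff * (-1) ^ a₂.natDegree) *
      ∏ i, (X - C (-β i)) := by
    conv_lhs => rw [hβ]
    rw [mul_comp, C_comp, prod_X_sub_C_comp_neg, Fintype.card_fin, ← mul_assoc, ← C_mul]
  have hsign : (a₂.leadingCoeff * (-1) ^ a₂.natDegree) ≠ 0 :=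
    mul_ne_zero hc₂ (pow_ne_zero _ (neg_ne_zero.2 one_ne_zero))
  tfae_have 1 → 3 := by
    rintro ⟨φ⟩
    -- With a single root on each side there is nothing to prove. This case is separated because
    -- rigidity needs degree at least two in the target.
    by_cases h1 : a₁.natDegree = 1 ∧ a₂.natDegree = 1
    · refine ⟨h1.1.trans h1.2.symm, 1, 1, Or.inl rfl, fun i => ?_⟩
      have : i = ⟨0, ha₁⟩ := Fin.ext (by have := i.2; dsimp only; omega)
      rw [this]
      simp
    have hle : ∀ {a b : k[X]} (φ : ClassicalGWA a ≃ₐ[k] ClassicalGWA b), 0 < a.natDegree →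
        2 ≤ b.natDegree → b.natDegree ≤ a.natDegree := by
      intro a b φ ha hb
      obtain ⟨b', c, hb', hdvd⟩ := ClassicalGWA.exists_dvd_comp ha hb φ
      have h0 : a.comp (X + C c) ≠ 0 := by
        rw [Ne, comp_X_add_C_eq_zero_iff]
        rintro rfl
        simp at ha
      have := natDegree_le_of_dvd hdvd h0
      rcases hb' with rfl | rfl <;> simpa [natDegree_comp] using this
    -- One degree is at least two, and then the divisibility bound carries this over to the other.
    have h2 : 2 ≤ a₁.natDegree ∧ 2 ≤ a₂.natDegree := by
      by_cases h : 2 ≤ a₂.natDegree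
      · exact ⟨h.trans (hle φ ha₁ h), h⟩
      · have h' : 2 ≤ a₁.natDegree := by omega
        exact absurd (h'.trans (hle φ.symm ha₂ h')) h
    have e : a₁.natDegree = a₂.natDegree :=
      le_antisymm (hle φ.symm ha₂ h2.1) (hle φ ha₁ h2.2)
    obtain ⟨b, c, hb, q, hq⟩ := ClassicalGWA.exists_dvd_comp ha₁ h2.2 φ
    have hcomp0 : a₁.comp (X + C c) ≠ 0 := by
      rw [Ne, comp_X_add_C_eq_zero_iff]
      rintro rfl
      simp at ha₁
    have hbdeg : b.natDegree = a₂.natDegree := by rcases hb with rfl | rfl <;> simp [natDegree_comp]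
    have hb0 : b ≠ 0 := fun h => hcomp0 (by rw [hq, h, zero_mul])
    have hq0 : q ≠ 0 := fun h => hcomp0 (by rw [hq, h, mul_zero])
    -- Equal degrees turn the divisibility into equality up to a scalar.
    have hqdeg : q.natDegree = 0 := by
      have := congrArg natDegree hq
      rw [natDegree_comp, natDegree_X_add_C, mul_one, natDegree_mul hb0 hq0, hbdeg, e] at this
      omega
    obtain ⟨d, rfl⟩ : ∃ d, q = C d := ⟨_, eq_C_of_natDegree_eq_zero hqdeg⟩
    have hd : d ≠ 0 := C_ne_zero.1 hq0
    rw [hprod₁, mul_comm b] at hq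
    obtain ⟨ε, hε, σ, hσ⟩ : ∃ ε : k, (ε = 1 ∨ ε = -1) ∧
        ∃ σ : Fin a₁.natDegree ≃ Fin a₂.natDegree, ∀ i, ε * β (σ i) = α i - c := by
      rcases hb with rfl | rfl
      · have hq' := hq.trans (congrArg (C d * ·) hβ)
        rw [← mul_assoc, ← C_mul] at hq'
        obtain ⟨σ, hσ⟩ := exists_equiv_of_prod_eq hc₁ (mul_ne_zero hd hc₂) hq'
        exact ⟨1, Or.inl rfl, σ, fun i => by rw [one_mul, hσ]⟩
      · rw [hprod₂, ← mul_assoc, ← C_mul] at hq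
        obtain ⟨σ, hσ⟩ := exists_equiv_of_prod_eq hc₁ (mul_ne_zero hd hsign) hq
        exact ⟨-1, Or.inr rfl, σ, fun i => by rw [neg_one_mul, hσ]⟩
    refine ⟨e, σ.trans (finCongr e).symm, ε, hε, fun i => ?_⟩
    have hcast : ∀ i, Fin.cast e ((σ.trans (finCongr e).symm) i) = σ i := fun i => by simp
    rw [hcast, hcast, mul_sub, hσ, hσ]
    ring
  tfae_have 3 → 2 := by
    rintro ⟨e, τ, ε, hε, h⟩
    refine ⟨e, τ, fun i j => ?_⟩
    have hε2 : ε ^ 2 = 1 := by rcases hε with rfl | rfl <;> ring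
    have h1 : α i - α j = ε * (β (Fin.cast e (τ i)) - β (Fin.cast e (τ j))) := by
      linear_combination h i - h j
    rw [h1, mul_pow, hε2, one_mul]
  tfae_have 2 → 3 := by
    rintro ⟨e, τ, h⟩
    obtain ⟨ε, hε, hu⟩ := exists_sign_of_sq_eq (u := α) (v := fun i => β (Fin.cast e (τ i)))
      ⟨0, ha₁⟩ h
    exact ⟨e, τ, ε, hε, hu⟩
  tfae_have 3 → 1 := by
    rintro ⟨e, τ, ε, hε, h⟩
    -- The translation is chosen so that `α i = ε β (τ i) - γ` for all `i`, read off at the base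
    -- index.
    set γ := ε * β (Fin.cast e (τ ⟨0, ha₁⟩)) - α ⟨0, ha₁⟩ with hγ
    have hα' : ∀ i, α i = ε * β (Fin.cast e (τ i)) - γ := fun i => by
      rw [hγ]
      linear_combination h i
    have hprod : ∏ i, (X - C (α i)) = ∏ i, (X - C (ε * β i - γ)) := by
      refine Fintype.prod_equiv (τ.trans (finCongr e)) _ _ fun i => ?_
      rw [hα']
      simp
    have key : ∀ b : k[X], ∀ d : k, d ≠ 0 → b = C d * ∏ i, (X - C (ε * β i)) →
        Nonempty (ClassicalGWA a₁ ≃ₐ[k] ClassicalGWA b) := by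
      intro b d hd hb
      refine ClassicalGWA.nonempty_equiv_of_eq_comp (c := a₁.leadingCoeff / d) (γ := γ)
        (div_ne_zero hc₁ hd) ?_
      rw [hb, mul_comp, C_comp, prod_X_sub_C_comp_add, ← hprod, ← mul_assoc, ← C_mul,
        div_mul_cancel₀ _ hd]
      exact hα
    rcases hε with rfl | rfl
    · exact key a₂ _ hc₂ (by simpa only [one_mul] using hβ)
    · obtain ⟨F⟩ := key (a₂.comp (-X)) _ hsign (by simpa only [neg_one_mul] using hprod₂)
      exact ⟨F.trans (ClassicalGWA.swapEquiv rfl).symm⟩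
  tfae_finish
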